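/- **Schur function expansion of the Sato–Segal–Wilson tau function (Sato).** *Setting.* Let $\mathcal H=L^2(S^1)$ with orthonormal basis $e_j=z^{-j-1}$ ($j\in\mathbb Z$), and let $\mathcal H_+$ and $\mathcal H_-$ be the closed spans of $\{e_j\}_{j<0}$ and $\{e_j\}_{j\ge 0}$. Let $w\subset\mathcal H$ be a closed subspace whose orthogonal projection to $\mathcal H_+$ is Fredholm of index $0$ and whose orthogonal projection to $\mathcal H_-$ is Hilbert–Schmidt. Let $(w_0,w_1,\dots)$ be an admissible frame of $w$: there is a bounded injective linear map $\Phi:\mathcal H_+\to\mathcal H$ with image $w$ and $\Phi(z^j)=w_j$ such that the $\mathcal H_+$-component of $\Phi$ is the identity plus a trace class operator. Write $w_j=\sum_{i\in\mathbb Z}w_{ij}e_i$ and $W=(w_{ij})_{i\in\mathbb Z,\,j\in\mathbb N}$. The determinant of a semi-infinite matrix is the limit of its leading $N\times N$ minors as $N\to\infty$. For a partition $\lambda=(\lambda_1\ge\lambda_2\ge\cdots)$, extended by zeros, let $W_\lambda$ consist of the rows $\lambda_1-1,\lambda_2-2,\lambda_3-3,\dots$ of $W$, in this order. The Plücker coordinates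 of $w$ in this frame are $\pi_\lambda(w)=\det W_\lambda$. Let $\mathbf t=(t_1,t_2,\dots)$ be complex numbers with $\sum_i|t_i|<\infty$ and $\sum_i i|t_i|^2<\infty$ (this holds for all finitely supported $\mathbf t$, and whenever $\sum_i t_iz^i$ is holomorphic near the closed unit disc). Put $\gamma(\mathbf t)=e^{\sum_{i\ge1}t_iz^i}$, let $W(\mathbf t)$ be the coordinate matrix of the frame $(\gamma(\mathbf t)w_j)_{j\ge 0}$ of $w(\mathbf t)=\gamma(\mathbf t)w$, and let $W_+(\mathbf t)$ consist of its rows $-1,-2,\dots$. The tau function is $\tau_w(\mathbf t)=\det W_+(\mathbf t)$. Define $h_n\in\mathbb C[t_1,t_2,\dots]$ by $e^{\sum_{i\ge1}t_iz^i}=\sum_{n\ge0}h_n(\mathbf t)z^n$, with $h_n=0$ for $n<0$, and let $s_\lambda(\mathbf t)=\det\big(h_{\lambda_i-i+j}(\mathbf t)\big)_{1\le i,j\le\ell(\lambda)}$ be the Schur functions. Let $s_\lambda(\partial_{\mathbf t})$ be the differential operator obtained from $s_\lambda$ by replacing $t_i$ with $\frac1i\frac{\partial}{\partial t_i}$. *Proposition.*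 The determinants defining $\pi_\lambda(w)$ (for all $\lambda$) and $\tau_w(\mathbf t)$ (for all $\mathbf t$ as above) exist, and $$\tau_w(\mathbf t)=\sum_\lambda\pi_\lambda(w)\,s_\lambda(\mathbf t),$$ where the sum over all partitions converges absolutely. Moreover $\tau_w$ is holomorphic in any finite number of the variables $t_i$ (the others being set to $0$), and for every partition $\lambda$ $$\pi_\lambda(w)=s_\lambda(\partial_{\mathbf t})\,\tau_w(\mathbf t)\big|_{\mathbf t=\mathbf 0}.$$ -/

import Mathlib

open MeasureTheory Filter Topology

noncomputable section

namespace KP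

/-! ### The polarized Hilbert space `L²(S¹)` and its Grassmannian -/

/-- The Hilbert space `L²(S¹)`; the unit circle is parametrised by `z = exp (2 π i x)`, `x ∈ ℝ/ℤ`,
and carries its normalised Haar measure. The monomial `zⁿ` is Mathlib's `fourierLp 2 n`. -/
abbrev H : Type := Lp ℂ 2 (@AddCircle.haarAddCircle (1 : ℝ) _)

/-- The monomial `zⁿ`, `n ∈ ℤ`, as an element of `L²(S¹)`. -/
def zpow (n : ℤ) : H := fourierLp 2 n

/-- The orthonormal basis vectors `e_j = z^{-j-1}`. -/
def e (j : ℤ) : H := zpow (-j - 1)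

/-- `H₊`, the closed span of the `e_j` with `j < 0`, that is of the `zⁿ` with `n ≥ 0`. -/
def Hplus : Submodule ℂ H := (Submodule.span ℂ (e '' {j : ℤ | j < 0})).topologicalClosure

/-- `H₋`, the closed span of the `e_j` with `j ≥ 0`, that is of the `zⁿ` with `n < 0`. -/
def Hminus : Submodule ℂ H := (Submodule.span ℂ (e '' {j : ℤ | 0 ≤ j})).topologicalClosure

instance : CompleteSpace Hplus :=
  (Submodule.isClosed_topologicalClosure _).completeSpace_coe

instance : CompleteSpace Hminus :=
  (Submodule.isClosed_topologicalClosure _).completeSpace_coe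

/-- Orthogonal projection `L²(S¹) → H₊`. -/
def projPlus : H →L[ℂ] Hplus := Hplus.orthogonalProjectionOnto

/-- Orthogonal projection `L²(S¹) → H₋`. -/
def projMinus : H →L[ℂ] Hminus := Hminus.orthogonalProjectionOnto

theorem zpow_mem_Hplus (n : ℕ) : zpow n ∈ Hplus := by
  apply Submodule.le_topologicalClosure
  apply Submodule.subset_span
  refine ⟨-(n : ℤ) - 1, ?_, ?_⟩
  · simp only [Set.mem_ofPred_eq]; omega
  · simp only [e]; congr 1; ring

/-- A bounded operator is Hilbert-Schmidt if `∑ ‖T bᵢ‖² < ∞` for some (equivalently, for every)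
orthonormal Hilbert basis `b` of its domain. -/
def IsHilbertSchmidt {E F : Type*} [NormedAddCommGroup E] [InnerProductSpace ℂ E]
    [NormedAddCommGroup F] [InnerProductSpace ℂ F] (T : E →L[ℂ] F) : Prop :=
  ∃ (s : Set E) (b : HilbertBasis s ℂ E), Summable fun i => ‖T (b i)‖ ^ 2

/-- A bounded operator on a Hilbert space is of trace class iff it is nuclear, that is
`T v = ∑ₙ ⟨yₙ, v⟩ xₙ` with `∑ₙ ‖xₙ‖ ‖yₙ‖ < ∞`. -/
def IsTraceClass {E : Type*} [NormedAddCommGroup E] [InnerProductSpace ℂ E]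
    (T : E →L[ℂ] E) : Prop :=
  ∃ x y : ℕ → E, (Summable fun n => ‖x n‖ * ‖y n‖) ∧
    ∀ v, HasSum (fun n => inner ℂ (y n) v • x n) (T v)

/-- The Hilbert space Grassmannian (virtual dimension zero): closed subspaces `w ⊆ H` such that
`w → H₊` is Fredholm of index zero and `w → H₋` is Hilbert-Schmidt. -/
def Gr : Set (Submodule ℂ H) :=
  {w | IsClosed (w : Set H) ∧
    ContinuousLinearMap.IsFredholm (projPlus ∘L w.subtypeL) ∧
    Module.finrank ℂ (projPlus ∘L w.subtypeL).ker =
      Module.finrank ℂ (Hplus ⧸ (projPlus ∘L w.subtypeL).range) ∧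
    IsHilbertSchmidt (projMinus ∘L w.subtypeL)}

/-- `f = (w₀, w₁, …)` is an admissible frame of the subspace `w`: there is a bounded injective
linear map `H₊ → H` with image `w` that sends `zʲ` to `wⱼ` and whose `H₊`-component differs from
the identity by an operator of trace class. -/
def IsAdmissibleFrame (w : Submodule ℂ H) (f : ℕ → H) : Prop :=
  ∃ Φ : Hplus →L[ℂ] H, Function.Injective Φ ∧ Φ.range = w ∧
    (∀ j : ℕ, Φ ⟨zpow j, zpow_mem_Hplus j⟩ = f j) ∧
    IsTraceClass (projPlus ∘L Φ - ContinuousLinearMap.id ℂ Hplus)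

/-! ### Semi-infinite determinants, Plücker coordinates and the tau function -/

/-- The semi-infinite matrix `A` has determinant `d`: the leading `N × N` minors of `A` converge
to `d` as `N → ∞`. -/
def HasInfDet (A : Matrix ℕ ℕ ℂ) (d : ℂ) : Prop :=
  Tendsto (fun N : ℕ => (A.submatrix (Fin.val : Fin N → ℕ) (Fin.val : Fin N → ℕ)).det)
    atTop (𝓝 d)

/-- The determinant of a semi-infinite matrix (meaningful when `HasInfDet A d` for some `d`). -/
def infDet (A : Matrix ℕ ℕ ℂ) : ℂ :=
  limUnder atTop
    (fun N : ℕ => (A.submatrix (Fin.val : Fin N → ℕ) (Fin.val : Fin N → ℕ)).det)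

/-- The `ℤ × ℕ` matrix of a sequence of functions on the circle: column `j` lists the
coefficients of `g j` along the `e_i = z^{-i-1}`, `i ∈ ℤ`. -/
def coordMatrix (g : ℕ → AddCircle (1 : ℝ) → ℂ) : Matrix ℤ ℕ ℂ :=
  Matrix.of fun i j => fourierCoeff (g j) (-i - 1)

/-- The rows `λ_k - k`, `k = 1, 2, …`, of a `ℤ × ℕ` matrix, in this order; for the empty diagram
these are the rows `-1, -2, …` of the upper block. Here `μ.rowLen k` is the part `λ_{k+1}`. -/
def rowsOf (μ : YoungDiagram) (W : Matrix ℤ ℕ ℂ) : Matrix ℕ ℕ ℂ :=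
  Matrix.of fun k j => W ((μ.rowLen k : ℤ) - (k + 1)) j

/-- The matrix `W` of a frame. -/
def frameMatrix (f : ℕ → H) : Matrix ℤ ℕ ℂ := coordMatrix fun j x => f j x

/-- The Plücker coordinate `π_λ = det W_λ`. -/
def plucker (f : ℕ → H) (μ : YoungDiagram) : ℂ := infDet (rowsOf μ (frameMatrix f))

/-- The flow parameters `t = (t₁, t₂, …)`: `∑ |tᵢ| < ∞` and `∑ i |tᵢ|² < ∞`. -/
def IsFlowParam (t : ℕ+ → ℂ) : Prop :=
  (Summable fun i => ‖t i‖) ∧ Summable fun i : ℕ+ => (i : ℝ) * ‖t i‖ ^ 2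

/-- The function `γ(t) = exp (∑_{i ≥ 1} tᵢ zⁱ)` on the circle. -/
def gamma (t : ℕ+ → ℂ) (x : AddCircle (1 : ℝ)) : ℂ :=
  Complex.exp (∑' i : ℕ+, t i * fourier (i : ℤ) x)

/-- The matrix `W(t)` of the frame `γ(t) w₀, γ(t) w₁, …` of `w(t) = γ(t) w`. -/
def flowMatrix (f : ℕ → H) (t : ℕ+ → ℂ) : Matrix ℤ ℕ ℂ :=
  coordMatrix fun j x => gamma t x * f j x

/-- The tau function `τ_w(t) = π_∅(w(t)) = det W₊(t)`. -/
def tau (f : ℕ → H) (t : ℕ+ → ℂ) : ℂ := infDet (rowsOf ⊥ (flowMatrix f t))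

/-! ### Schur functions in the flow variables -/

/-- The complete symmetric functions `h_n ∈ ℂ[t₁, t₂, …]`:
`exp (∑_{i ≥ 1} tᵢ zⁱ) = ∑_n h_n zⁿ` as formal power series in `z`. -/
def completeH (n : ℕ) : MvPolynomial ℕ+ ℂ :=
  PowerSeries.coeff n
    ((PowerSeries.exp (MvPolynomial ℕ+ ℂ)).subst
      (PowerSeries.mk fun i : ℕ => if hi : 0 < i then
        (MvPolynomial.X (i.toPNat hi) : MvPolynomial ℕ+ ℂ) else 0))

/-- `h_m` for integer index, with `h_m = 0` for `m < 0`. -/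
def completeHInt (m : ℤ) : MvPolynomial ℕ+ ℂ := if 0 ≤ m then completeH m.toNat else 0

/-- The Schur function `s_λ = det (h_{λ_i - i + j})_{1 ≤ i, j ≤ ℓ(λ)}`. -/
def schur (μ : YoungDiagram) : MvPolynomial ℕ+ ℂ :=
  (Matrix.of fun i j : Fin (μ.colLen 0) =>
    completeHInt ((μ.rowLen i : ℤ) - (i : ℤ) + (j : ℤ))).det

/-! ### Constant coefficient differential operators -/

/-- The operator `(1/i) ∂/∂tᵢ`. -/
def dt (i : ℕ+) (F : (ℕ+ → ℂ) → ℂ) : (ℕ+ → ℂ) → ℂ :=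
  fun t => (1 / (i : ℂ)) * lineDeriv ℂ F t (Pi.single i 1)

/-- The operator `∏ᵢ ((1/i) ∂/∂tᵢ)^{αᵢ}`. -/
def dtMonomial (α : ℕ+ →₀ ℕ) (F : (ℕ+ → ℂ) → ℂ) : (ℕ+ → ℂ) → ℂ :=
  ((Finsupp.toMultiset α).sort (· ≤ ·)).foldr dt F

/-- The operator `p(∂_t)` obtained from a polynomial `p` in `t₁, t₂, …` by substituting
`(1/i) ∂/∂tᵢ` for `tᵢ`. -/
def polyDt (p : MvPolynomial ℕ+ ℂ) (F : (ℕ+ → ℂ) → ℂ) : (ℕ+ → ℂ) → ℂ :=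
  fun t => ∑ α ∈ p.support, p.coeff α * dtMonomial α F t

/-- Extension by zero of the values of finitely many flow variables. -/
def extendZero (s : Finset ℕ+) (u : s → ℂ) : ℕ+ → ℂ :=
  fun i => if hi : i ∈ s then u ⟨i, hi⟩ else 0

end KP

end

/-!
The proof only uses the Fourier coefficients `V n j` of the frame vectors. Admissibility makes
`V` a *near-standard* matrix: it differs from `δ_{nj}` by a Hilbert–Schmidt matrix with absolutely
summable diagonal (`IsAdmissibleFrame.isNearStandard`). Hadamard's inequality in the form
`|det A|² ≤ exp (‖A‖² - n)` for `n × n` matrices, `‖A‖` being the Hilbert–Schmidt norm, makes the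
leading minors of a near-standard matrix a Cauchy sequence (`exists_hasInfDet`), so the Plücker
coordinates exist.

For the expansion, the `N`-th leading minor of `W₊(t)` is the limit as `M → ∞` of the determinant
of a product of an `N × (N + M)` block of the Toeplitz matrix of multiplication by `γ(t)` and an
`(N + M) × N` block of the frame. Cauchy–Binet writes it as a sum over the maximal minors, which
are indexed by the Young diagrams in an `N × M` box: those of the Toeplitz block are the Schur
functions `s_λ(t)`, by Jacobi–Trudi, and those of the frame block are the `N`-th leading minors
approximating the Plücker coordinates `π_λ`. Two uniform bounds on sums of squared minors justify
the passage to the limit. By Cauchy–Binet again, the sum of the squared maximal minors of a block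
is a Gram determinant; for the frame this is bounded because `V` is near-standard, and for the
Toeplitz block because, after multiplication by a unitriangular matrix, it becomes the identity
next to a block controlled by the Hankel matrix of the `h_n(t)`, whose squared Hilbert–Schmidt norm
`∑ k |h_k(t)|²` is controlled by `∑ |tᵢ|` and `∑ i |tᵢ|²` (`sum_box_norm_schur_sq_le`). Hence
`(π_λ)` and `(s_λ(t))` are square summable, and a bounded sequence in `ℓ²` converging
coordinatewise converges weakly (`IsNearStandard.schur_expansion`).

The bound on `∑ |s_λ(t)|²` is uniform on bounded sets of finitely many variables, so the expansion
converges uniformly there, as do all its derivatives, by Cauchy's estimates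
(`contDiff_of_tendstoUniformlyOn`, `tendsto_foldr_dt`). Applying `s_μ(∂_t)` termwise at `t = 0`
leaves `π_μ`, since the Schur functions are orthonormal for the pairing `P(∂_t) Q |_{t = 0}`
(`hallForm_schur_schur`). The latter is proved with the bialternant formula: in the variables
`tᵢ = (1/i) ∑_k x_kⁱ`, the functional `⟨s_μ, ·⟩` extracts a coefficient of the product with the
Vandermonde determinant.
-/

noncomputable section

namespace KP

/-! ### Determinants of finite matrices -/

/-- Multilinear expansion of the determinant in the rows of `A * B`, which are combinations of the
rows of `B`. The terms with `p` not injective vanish. -/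
theorem det_mul_eq_sum_fun {R : Type*} [CommRing R] {n m : Type*} [Fintype n] [DecidableEq n]
    [Fintype m] (A : Matrix n m R) (B : Matrix m n R) :
    (A * B).det = ∑ p : n → m, (∏ i, A i (p i)) * (B.submatrix p id).det := by
  classical
  have h : (A * B).det = Matrix.detRowAlternating.toMultilinearMap
      (fun i => ∑ k, A i k • B k) := by
    change (A * B).det = Matrix.det _
    congr 1
    ext i j
    simp [Matrix.mul_apply, Finset.sum_apply]
  rw [h, MultilinearMap.map_sum]
  refine Finset.sum_congr rfl fun p _ => ?_
  rw [MultilinearMap.map_smul_univ, smul_eq_mul]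
  rfl

/-- The **Cauchy–Binet formula**. -/
theorem det_mul_eq_sum_orderEmbedding {R : Type*} [CommRing R] {N : ℕ} {m : Type*} [Fintype m]
    [LinearOrder m] (A : Matrix (Fin N) m R) (B : Matrix m (Fin N) R) :
    (A * B).det = ∑ g : Fin N ↪o m, (A.submatrix id g).det * (B.submatrix g id).det := by
  classical
  rw [det_mul_eq_sum_fun]
  have key : ∀ g : Fin N ↪o m, (A.submatrix id g).det * (B.submatrix g id).det =
      ∑ σ : Equiv.Perm (Fin N), (∏ i, A i (g (σ i))) * (B.submatrix (g ∘ σ) id).det := by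
    intro g
    rw [← Matrix.det_transpose, Matrix.det_apply', Finset.sum_mul]
    refine Finset.sum_congr rfl fun σ _ => ?_
    have : B.submatrix (g ∘ σ) id = (B.submatrix g id).submatrix σ id := rfl
    rw [this, Matrix.det_permute]
    simp only [Matrix.transpose_apply, Matrix.submatrix_apply, id]
    ring
  rw [Finset.sum_congr rfl fun g _ => key g, ← Fintype.sum_prod_type']
  symm
  refine Finset.sum_of_injOn (fun x : (Fin N ↪o m) × Equiv.Perm (Fin N) => x.1 ∘ x.2) ?_
    (fun _ _ => Finset.mem_coe.2 (Finset.mem_univ _)) ?_ (fun _ _ => rfl)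
  · rintro ⟨f, σ⟩ - ⟨g, τ⟩ - h
    have hr : Set.range f = Set.range g := by
      have := congrArg Set.range h
      simpa [Set.range_comp] using this
    have hfg : f = g := by
      exact DFunLike.coe_injective ((StrictMono.range_inj f.strictMono g.strictMono).1 hr)
    subst hfg
    simp only [Prod.mk.injEq, true_and]
    ext i
    exact congrArg Fin.val (f.injective (congrFun h i))
  · intro p _ hp
    by_cases hinj : Function.Injective p
    · exfalso
      apply hp
      have hm : StrictMono (p ∘ Tuple.sort p) :=
        (Tuple.monotone_sort p).strictMono_of_injective (hinj.comp (Tuple.sort p).injective)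
      refine ⟨(OrderEmbedding.ofStrictMono _ hm, (Tuple.sort p)⁻¹), by simp, ?_⟩
      ext i
      simp
    · simp only [Function.Injective, not_forall] at hinj
      obtain ⟨i, j, hij, hne⟩ := hinj
      rw [Matrix.det_zero_of_row_eq hne (by ext k; simp [hij]), mul_zero]

open scoped ComplexOrder in
/-- A form of Hadamard's inequality: a Gram determinant is at most the exponential of the trace
of the Gram matrix minus the identity, because `x ≤ exp (x - 1)` for each eigenvalue `x`. -/
theorem norm_det_conjTranspose_mul_self_le {m n : Type*} [Fintype m] [Fintype n] [DecidableEq n]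
    (M : Matrix m n ℂ) :
    ‖(M.conjTranspose * M).det‖ ≤
      Real.exp (∑ j, ∑ i, ‖M i j‖ ^ 2 - Fintype.card n) := by
  have hp := Matrix.posSemidef_conjTranspose_mul_self M
  have ht := hp.isHermitian.trace_eq_sum_eigenvalues
  have ht' : ∑ j, ∑ i, ‖M i j‖ ^ 2 = ∑ j, hp.isHermitian.eigenvalues j := by
    have : (M.conjTranspose * M).trace = ((∑ j, ∑ i, ‖M i j‖ ^ 2 : ℝ) : ℂ) := by
      simp only [Matrix.trace, Matrix.diag, Matrix.mul_apply, Matrix.conjTranspose_apply]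
      push_cast
      refine Finset.sum_congr rfl fun j _ => Finset.sum_congr rfl fun i _ => ?_
      exact Complex.conj_mul' _
    rw [this] at ht
    apply Complex.ofReal_injective
    rw [ht]
    simp
  rw [hp.isHermitian.det_eq_prod_eigenvalues, ht', norm_prod]
  have hc : (Fintype.card n : ℝ) = ∑ _j : n, (1 : ℝ) := by simp
  rw [hc, ← Finset.sum_sub_distrib, Real.exp_sum]
  refine Finset.prod_le_prod (fun _ _ => norm_nonneg _) fun j _ => ?_
  have h0 := hp.eigenvalues_nonneg j
  simp only [Complex.coe_algebraMap, Complex.norm_real, Real.norm_eq_abs, abs_of_nonneg h0]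
  linarith [Real.add_one_le_exp (hp.isHermitian.eigenvalues j - 1)]

theorem norm_det_sq_le {n : Type*} [Fintype n] [DecidableEq n] (M : Matrix n n ℂ) :
    ‖M.det‖ ^ 2 ≤ Real.exp (∑ j, ∑ i, ‖M i j‖ ^ 2 - Fintype.card n) := by
  refine le_trans (le_of_eq ?_) (norm_det_conjTranspose_mul_self_le M)
  rw [Matrix.det_mul, Matrix.det_conjTranspose, norm_mul, norm_star, sq]

/-- By Cauchy–Binet the sum of the squares of all maximal minors is a Gram determinant. -/
theorem sum_norm_det_submatrix_sq_le {N : ℕ} {m : Type*} [Fintype m] [LinearOrder m]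
    (B : Matrix m (Fin N) ℂ) :
    ∑ g : Fin N ↪o m, ‖(B.submatrix g id).det‖ ^ 2 ≤
      Real.exp (∑ j, ∑ i, ‖B i j‖ ^ 2 - N) := by
  have h := norm_det_conjTranspose_mul_self_le B
  rw [Fintype.card_fin] at h
  refine le_trans (le_of_eq ?_) h
  rw [det_mul_eq_sum_orderEmbedding]
  have : ∀ g : Fin N ↪o m, (B.conjTranspose.submatrix id g).det * (B.submatrix g id).det =
      ((‖(B.submatrix g id).det‖ ^ 2 : ℝ) : ℂ) := by
    intro g
    have : B.conjTranspose.submatrix id g = (B.submatrix g id).conjTranspose := rfl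
    rw [this, Matrix.det_conjTranspose]
    push_cast
    exact Complex.conj_mul' _
  rw [Finset.sum_congr rfl fun g _ => this g, ← Complex.ofReal_sum, Complex.norm_real,
    Real.norm_eq_abs, abs_of_nonneg (Finset.sum_nonneg fun _ _ => by positivity)]

/-- For an entry `δ + k` of a perturbation of the identity: off the diagonal the bound is quadratic
in `k`, on the diagonal it has a linear term. -/
theorem norm_ite_add_sq_le {p : Prop} [Decidable p] (k : ℂ) :
    ‖(if p then 1 else 0) + k‖ ^ 2 ≤ (if p then 1 + 2 * ‖k‖ else 0) + ‖k‖ ^ 2 := by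
  split_ifs
  · have := norm_add_le 1 k
    rw [norm_one] at this
    nlinarith [norm_nonneg (1 + k)]
  · simp

/-! ### Semi-infinite determinants -/

/-- If the leading minors converge, `infDet` is their limit and not a junk value. -/
theorem HasInfDet.infDet {A : Matrix ℕ ℕ ℂ} {d : ℂ} (h : HasInfDet A d) :
    HasInfDet A (infDet A) := by
  have : KP.infDet A = d := h.limUnder_eq
  rwa [this]

/-- The determinant is affine in the corner entry; the remaining term has the corner set to zero. -/
theorem det_castSucc_expand {N : ℕ} (M : Matrix (Fin (N + 1)) (Fin (N + 1)) ℂ) :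
    M.det = M (Fin.last N) (Fin.last N) * (M.submatrix Fin.castSucc Fin.castSucc).det +
      (Matrix.of fun i j => if i = Fin.last N ∧ j = Fin.last N then 0 else M i j).det := by
  have hM : M = M.updateCol (Fin.last N)
      ((fun i => if i = Fin.last N then M i i else 0) +
        (fun i => if i = Fin.last N then 0 else M i (Fin.last N))) := by
    ext i j
    by_cases hj : j = Fin.last N
    · subst hj
      by_cases hi : i = Fin.last N <;> simp [hi]
    · simp [Matrix.updateCol_ne hj]
  conv_lhs => rw [hM, Matrix.det_updateCol_add]
  congr 1
  · rw [Matrix.det_succ_column _ (Fin.last N), Finset.sum_eq_single (Fin.last N)]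
    · have : (M.updateCol (Fin.last N) fun i => if i = Fin.last N then M i i else 0).submatrix
          (Fin.last N).succAbove (Fin.last N).succAbove =
          M.submatrix Fin.castSucc Fin.castSucc := by
        ext i j
        simp
      rw [this]
      simp
    · intro i _ hi
      simp [hi]
    · simp
  · congr 1
    ext i j
    by_cases hj : j = Fin.last N
    · subst hj
      simp
    · simp [hj]

/-- The leading minors of `1 + K` converge as soon as `K` is Hilbert–Schmidt with absolutely
summable diagonal. Passing from size `N` to size `N + 1` changes the minor by `K N N` times the old
minor plus a determinant bordered by the new row `r` and column `c`. Dividing the new row and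
column by `ε` with `ε² ≥ ‖r‖² + ‖c‖²`, Hadamard's inequality bounds the bordered determinant by
`C ε²`, and both contributions are summable in `N`. -/
theorem exists_hasInfDet {A K : Matrix ℕ ℕ ℂ} (hA : A = 1 + K)
    (hK : Summable fun p : ℕ × ℕ => ‖K p.1 p.2‖ ^ 2) (hd : Summable fun i => ‖K i i‖) :
    ∃ d, HasInfDet A d := by
  set C : ℝ := 2 * ∑' i, ‖K i i‖ + ∑' p : ℕ × ℕ, ‖K p.1 p.2‖ ^ 2 with hC
  have hAC : ∀ N : ℕ, ∑ j : Fin N, ∑ i : Fin N, ‖A i j‖ ^ 2 - N ≤ C := by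
    intro N
    have h1 : ∑ j : Fin N, ∑ i : Fin N, ‖A i j‖ ^ 2 ≤
        ∑ j : Fin N, ∑ i : Fin N, ((if i = j then 1 + 2 * ‖K i j‖ else 0) + ‖K i j‖ ^ 2) := by
      refine Finset.sum_le_sum fun j _ => Finset.sum_le_sum fun i _ => ?_
      have : A i j = (if i = j then 1 else 0) + K i j := by
        simp [hA, Matrix.one_apply, Fin.ext_iff]
      rw [this]
      exact norm_ite_add_sq_le _
    have h2 : ∑ j : Fin N, ∑ i : Fin N, ((if i = j then 1 + 2 * ‖K i j‖ else 0) + ‖K i j‖ ^ 2) =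
        N + 2 * ∑ i : Fin N, ‖K i i‖ + ∑ j : Fin N, ∑ i : Fin N, ‖K i j‖ ^ 2 := by
      simp [Finset.sum_add_distrib, Finset.mul_sum]
    have h3 : ∑ i : Fin N, ‖K i i‖ ≤ ∑' i, ‖K i i‖ := by
      rw [Fin.sum_univ_eq_sum_range (fun i => ‖K i i‖) N]
      exact hd.sum_le_tsum _ fun _ _ => norm_nonneg _
    have h4 : ∑ j : Fin N, ∑ i : Fin N, ‖K i j‖ ^ 2 ≤ ∑' p : ℕ × ℕ, ‖K p.1 p.2‖ ^ 2 := by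
      rw [Finset.sum_comm, Fin.sum_univ_eq_sum_range (fun i => ∑ j : Fin N, ‖K i j‖ ^ 2) N]
      simp_rw [fun i => Fin.sum_univ_eq_sum_range (fun j => ‖K i j‖ ^ 2) N]
      rw [← Finset.sum_product' (Finset.range N) (Finset.range N) (fun i j => ‖K i j‖ ^ 2)]
      exact hK.sum_le_tsum _ fun _ _ => by positivity
    linarith
  have hc : Summable fun N => ∑' i, ‖K i N‖ ^ 2 := hK.prod_symm.prod
  have hr : Summable fun N => ∑' i, ‖K N i‖ ^ 2 := hK.prod
  -- `E N` is `ε²`; the geometric term only serves to make it positive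
  set E : ℕ → ℝ := fun N => ∑' i, ‖K i N‖ ^ 2 + ∑' i, ‖K N i‖ ^ 2 + (1 / 2) ^ N with hE
  have hEs : Summable E := (hc.add hr).add summable_geometric_two
  have hEpos : ∀ N, 0 < E N := fun N =>
    add_pos_of_nonneg_of_pos (add_nonneg (tsum_nonneg fun _ => by positivity)
      (tsum_nonneg fun _ => by positivity)) (by positivity)
  set d : ℕ → ℂ := fun N => (A.submatrix (Fin.val : Fin N → ℕ) (Fin.val : Fin N → ℕ)).det
    with hdd
  have hdb : ∀ N, ‖d N‖ ≤ Real.exp (C / 2) := by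
    intro N
    have := norm_det_sq_le (A.submatrix (Fin.val : Fin N → ℕ) (Fin.val : Fin N → ℕ))
    have h2 : ‖d N‖ ^ 2 ≤ Real.exp (C / 2) ^ 2 := by
      rw [← Real.exp_nat_mul]
      refine this.trans (Real.exp_le_exp.2 ?_)
      have := hAC N
      simp only [Fintype.card_fin, Matrix.submatrix_apply]
      push_cast
      linarith
    exact le_of_sq_le_sq h2 (by positivity)
  have hstep : ∀ N, dist (d N) (d (N + 1)) ≤ Real.exp (C / 2) * (‖K N N‖ + E N) := by
    intro N
    set M := A.submatrix (Fin.val : Fin (N + 1) → ℕ) (Fin.val : Fin (N + 1) → ℕ) with hM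
    set M' : Matrix (Fin (N + 1)) (Fin (N + 1)) ℂ :=
      Matrix.of fun i j => if i = Fin.last N ∧ j = Fin.last N then 0 else M i j with hM'
    have hexp : d (N + 1) = A N N * d N + M'.det := by
      have := det_castSucc_expand M
      exact this
    set ε : ℝ := Real.sqrt (E N) with hε
    have hεpos : 0 < ε := Real.sqrt_pos.2 (hEpos N)
    have hεsq : ε ^ 2 = E N := Real.sq_sqrt (hEpos N).le
    have hεne : (ε : ℂ) ≠ 0 := by exact_mod_cast hεpos.ne'
    -- `M2` is `M'` with its last row and column divided by `ε`
    set D : Fin (N + 1) → ℂ := fun i => if i = Fin.last N then (ε : ℂ) else 1 with hD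
    have hDne : ∀ i, D i ≠ 0 := by
      intro i
      simp only [hD]
      split_ifs
      · exact hεne
      · exact one_ne_zero
    set M2 : Matrix (Fin (N + 1)) (Fin (N + 1)) ℂ :=
      Matrix.of fun i j => M' i j / (D i * D j) with hM2
    have hfac : M' = Matrix.diagonal D * M2 * Matrix.diagonal D := by
      ext i j
      rw [Matrix.mul_diagonal, Matrix.diagonal_mul]
      simp only [hM2, Matrix.of_apply]
      field_simp [hDne i, hDne j]
    have hprodD : ∏ i, D i = ε := by
      rw [Fin.prod_univ_castSucc]
      simp [hD, (Fin.castSucc_lt_last _).ne]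
    have hdetM' : ‖M'.det‖ = E N * ‖M2.det‖ := by
      rw [hfac, Matrix.det_mul, Matrix.det_mul, Matrix.det_diagonal, hprodD, ← hεsq]
      simp only [norm_mul, Complex.norm_real, Real.norm_eq_abs, abs_of_pos hεpos]
      ring
    have hM2b : ‖M2.det‖ ≤ Real.exp (C / 2) := by
      have h1 := norm_det_sq_le M2
      have h2 : ‖M2.det‖ ^ 2 ≤ Real.exp (C / 2) ^ 2 := by
        rw [← Real.exp_nat_mul]
        refine h1.trans (Real.exp_le_exp.2 ?_)
        rw [Fin.sum_univ_castSucc]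
        simp_rw [Fin.sum_univ_castSucc]
        have e1 : ∀ i j : Fin N, ‖M2 i.castSucc j.castSucc‖ = ‖A i j‖ := by
          intro i j
          simp [hM2, hM', hD, hM, (Fin.castSucc_lt_last _).ne]
        have hKA : ∀ i j : ℕ, i ≠ j → A i j = K i j := by
          intro i j hij
          simp [hA, hij]
        have e2 : ∀ i : Fin N, ‖M2 i.castSucc (Fin.last N)‖ ^ 2 = ‖K i N‖ ^ 2 / E N := by
          intro i
          rw [← hεsq]
          simp [hM2, hM', hD, hM, (Fin.castSucc_lt_last _).ne, div_pow, hKA _ _ i.2.ne]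
        have e3 : ∀ i : Fin N, ‖M2 (Fin.last N) i.castSucc‖ ^ 2 = ‖K N i‖ ^ 2 / E N := by
          intro i
          rw [← hεsq]
          simp [hM2, hM', hD, hM, (Fin.castSucc_lt_last _).ne, div_pow, hKA _ _ i.2.ne']
        have e4 : M2 (Fin.last N) (Fin.last N) = 0 := by simp [hM2, hM']
        simp_rw [e1, e2, e3, e4]
        rw [Finset.sum_add_distrib, ← Finset.sum_div, ← Finset.sum_div]
        have b1 : ∑ i : Fin N, ‖K i N‖ ^ 2 ≤ ∑' i, ‖K i N‖ ^ 2 := by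
          rw [Fin.sum_univ_eq_sum_range (fun i => ‖K i N‖ ^ 2) N]
          exact (hK.prod_symm.prod_factor N).sum_le_tsum _ fun _ _ => by positivity
        have b2 : ∑ i : Fin N, ‖K N i‖ ^ 2 ≤ ∑' i, ‖K N i‖ ^ 2 := by
          rw [Fin.sum_univ_eq_sum_range (fun i => ‖K N i‖ ^ 2) N]
          exact (hK.prod_factor N).sum_le_tsum _ fun _ _ => by positivity
        have b3 : (∑ i : Fin N, ‖K N i‖ ^ 2) / E N + (∑ i : Fin N, ‖K i N‖ ^ 2) / E N ≤ 1 := by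
          rw [← add_div, div_le_one (hEpos N)]
          have : (0 : ℝ) < (1 / 2) ^ N := by positivity
          simp only [hE]
          linarith
        have := hAC N
        simp only [Fintype.card_fin, norm_zero]
        push_cast
        linarith
      exact le_of_sq_le_sq h2 (by positivity)
    have hAN : A N N = 1 + K N N := by simp [hA]
    rw [dist_comm, dist_eq_norm, hexp, hAN]
    calc ‖(1 + K N N) * d N + M'.det - d N‖ = ‖K N N * d N + M'.det‖ := by congr 1; ring
      _ ≤ ‖K N N‖ * ‖d N‖ + E N * ‖M2.det‖ := by
        rw [← hdetM', ← norm_mul]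
        exact norm_add_le _ _
      _ ≤ ‖K N N‖ * Real.exp (C / 2) + E N * Real.exp (C / 2) := by
        have := (hEpos N).le
        gcongr
        exact hdb N
      _ = _ := by ring
  obtain ⟨x, hx⟩ := cauchySeq_tendsto_of_complete
    (cauchySeq_of_dist_le_of_summable _ hstep ((hd.add hEs).mul_left _))
  exact ⟨x, hx⟩

/-! ### Complete symmetric functions -/

section CompleteH

variable {A : Type*} [CommRing A]

/-- The power series `∑_{i ≥ 1} tᵢ zⁱ` over a `ℂ`-algebra. -/
def flowSeries (t : ℕ+ → A) : PowerSeries A :=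
  PowerSeries.mk fun i : ℕ => if hi : 0 < i then t (i.toPNat hi) else 0

theorem coeff_flowSeries_zero (t : ℕ+ → A) : PowerSeries.coeff 0 (flowSeries t) = 0 := by
  simp [flowSeries]

theorem coeff_flowSeries_pnat (t : ℕ+ → A) (i : ℕ+) :
    PowerSeries.coeff (i : ℕ) (flowSeries t) = t i := by
  simp only [flowSeries, PowerSeries.coeff_mk, i.pos, dite_true]
  rfl

theorem coeff_flowSeries_succ (t : ℕ+ → A) (i : ℕ) :
    PowerSeries.coeff (i + 1) (flowSeries t) = t i.succPNat := by
  simpa using coeff_flowSeries_pnat t i.succPNat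

theorem hasSubst_flowSeries (t : ℕ+ → A) : PowerSeries.HasSubst (flowSeries t) :=
  PowerSeries.HasSubst.of_constantCoeff_zero' (by
    rw [← PowerSeries.coeff_zero_eq_constantCoeff_apply, coeff_flowSeries_zero])

variable [Algebra ℂ A]

/-- The power series `∑_n h_n(t) zⁿ = exp (∑_{i ≥ 1} tᵢ zⁱ)` over a `ℂ`-algebra. -/
def hSeries (t : ℕ+ → A) : PowerSeries A :=
  PowerSeries.mk fun n => MvPolynomial.aeval t (completeH n)

theorem hSeries_eq_subst [Algebra ℚ A] (t : ℕ+ → A) :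
    hSeries t = (PowerSeries.exp A).subst (flowSeries t) := by
  let φ : MvPolynomial ℕ+ ℂ →+* A := (MvPolynomial.aeval t : MvPolynomial ℕ+ ℂ →ₐ[ℂ] A)
  have h1 := PowerSeries.map_subst (hasSubst_flowSeries (MvPolynomial.X : ℕ+ → MvPolynomial ℕ+ ℂ))
    (h := φ) (PowerSeries.exp (MvPolynomial ℕ+ ℂ))
  rw [PowerSeries.map_exp] at h1
  have h2 : (MvPowerSeries.map φ)
      (flowSeries (MvPolynomial.X : ℕ+ → MvPolynomial ℕ+ ℂ)) = flowSeries t := by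
    change PowerSeries.map φ _ = _
    ext i
    rw [PowerSeries.coeff_map]
    simp only [flowSeries, PowerSeries.coeff_mk]
    split_ifs
    · simp [φ]
    · simp
  rw [h2] at h1
  rw [← h1]
  change _ = PowerSeries.map φ _
  ext n
  rw [PowerSeries.coeff_map, hSeries, PowerSeries.coeff_mk]
  rfl

theorem coeff_zero_hSeries (t : ℕ+ → A) : PowerSeries.coeff 0 (hSeries t) = 1 := by
  let _ : Algebra ℚ A := Algebra.compHom A (algebraMap ℚ ℂ)
  rw [hSeries_eq_subst, PowerSeries.coeff_subst' (hasSubst_flowSeries t),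
    finsum_eq_single _ 0]
  · simp
  · intro n hn
    rw [PowerSeries.coeff_zero_eq_constantCoeff_apply (flowSeries t ^ n), map_pow,
      ← PowerSeries.coeff_zero_eq_constantCoeff_apply, coeff_flowSeries_zero, zero_pow hn,
      smul_zero]

theorem derivative_hSeries (t : ℕ+ → A) :
    PowerSeries.derivative A (hSeries t) =
      hSeries t * PowerSeries.derivative A (flowSeries t) := by
  let _ : Algebra ℚ A := Algebra.compHom A (algebraMap ℚ ℂ)
  rw [hSeries_eq_subst, PowerSeries.derivative_subst (hasSubst_flowSeries t),
    PowerSeries.derivative_exp]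

/-- The recursion `n h_n = ∑_{i=1}^n i tᵢ h_{n-i}`, from `(exp T)' = T' exp T`. -/
theorem succ_mul_completeH (n : ℕ) :
    completeH (n + 1) * ((n : MvPolynomial ℕ+ ℂ) + 1) =
      ∑ p ∈ Finset.HasAntidiagonal.antidiagonal n,
        completeH p.1 * (MvPolynomial.X p.2.succPNat * ((p.2 : MvPolynomial ℕ+ ℂ) + 1)) := by
  have h := congrArg (PowerSeries.coeff n)
    (derivative_hSeries (MvPolynomial.X : ℕ+ → MvPolynomial ℕ+ ℂ))
  rw [PowerSeries.coeff_derivative, PowerSeries.coeff_mul] at h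
  simp only [PowerSeries.coeff_derivative, coeff_flowSeries_succ, hSeries, PowerSeries.coeff_mk,
    MvPolynomial.aeval_X_left_apply] at h
  exact h

theorem completeH_zero : completeH 0 = 1 := by
  have := coeff_zero_hSeries (MvPolynomial.X : ℕ+ → MvPolynomial ℕ+ ℂ)
  rwa [hSeries, PowerSeries.coeff_mk, MvPolynomial.aeval_X_left_apply] at this

theorem completeHInt_of_neg {m : ℤ} (hm : m < 0) : completeHInt m = 0 := by
  simp [completeHInt, not_le.2 hm]

theorem completeHInt_natCast (n : ℕ) : completeHInt n = completeH n := by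
  simp [completeHInt]

theorem completeHInt_zero : completeHInt 0 = 1 := by
  simpa [completeH_zero] using completeHInt_natCast 0

/-- The recursion for all integral indices; the bound `n` on the number of terms is arbitrary as
long as `m ≤ n`, since the other terms vanish. -/
theorem intCast_mul_completeHInt (n : ℕ) (m : ℤ) (hm : m ≤ n) :
    (m : MvPolynomial ℕ+ ℂ) * completeHInt m =
      ∑ a ∈ Finset.range n, ((a : MvPolynomial ℕ+ ℂ) + 1) * MvPolynomial.X a.succPNat *
        completeHInt (m - (a + 1)) := by
  rcases lt_trichotomy m 0 with h | h | h
  · rw [completeHInt_of_neg h, mul_zero, Finset.sum_eq_zero]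
    intro a _
    rw [completeHInt_of_neg (by lia), mul_zero]
  · subst h
    rw [Int.cast_zero, zero_mul, Finset.sum_eq_zero]
    intro a _
    rw [completeHInt_of_neg (by lia), mul_zero]
  · obtain ⟨k, rfl⟩ : ∃ k : ℕ, m = (k : ℤ) + 1 := ⟨(m - 1).toNat, by lia⟩
    have hk : k + 1 ≤ n := by lia
    rw [← Finset.sum_subset (Finset.range_subset_range.2 hk)]
    · have := succ_mul_completeH k
      rw [Finset.Nat.sum_antidiagonal_eq_sum_range_succ
        (fun i j => completeH i * (MvPolynomial.X j.succPNat * ((j : MvPolynomial ℕ+ ℂ) + 1))),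
        ← Finset.sum_range_reflect] at this
      have h1 : completeHInt ((k : ℤ) + 1) = completeH (k + 1) := by
        exact_mod_cast completeHInt_natCast (k + 1)
      rw [h1]
      push_cast
      rw [mul_comm, this]
      refine Finset.sum_congr rfl fun a ha => ?_
      have ha' : a ≤ k := by simpa [Nat.lt_succ_iff] using ha
      have e1 : k + 1 - 1 - a = k - a := by lia
      have e2 : k - (k - a) = a := by lia
      have e3 : (k : ℤ) + 1 - (a + 1) = ((k - a : ℕ) : ℤ) := by lia
      rw [e1, e2, e3, completeHInt_natCast]
      ring
    · intro a _ ha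
      have : k + 1 ≤ a := by simpa using ha
      rw [completeHInt_of_neg (by lia), mul_zero]

/-- `∂h_m / ∂t_j = h_{m-j}`, by induction from the recursion `m h_m = ∑ i tᵢ h_{m-i}`. -/
theorem pderiv_completeHInt (j : ℕ+) (m : ℤ) :
    MvPolynomial.pderiv j (completeHInt m) = completeHInt (m - j) := by
  have key : ∀ n : ℕ, ∀ m : ℤ, m ≤ n →
      MvPolynomial.pderiv j (completeHInt m) = completeHInt (m - j) := by
    intro n
    induction n with
    | zero =>
      intro m hm
      have hj := j.pos
      rw [completeHInt_of_neg (m := m - j) (by lia)]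
      rcases lt_or_eq_of_le hm with h | h
      · rw [completeHInt_of_neg (by simpa using h), map_zero]
      · have : m = 0 := by simpa using h
        rw [this, completeHInt_zero, MvPolynomial.pderiv_one]
    | succ n ih =>
      intro m hm
      rcases le_or_gt m n with h | h
      · exact ih m h
      have hm' : m = (n : ℤ) + 1 := by push_cast at hm; lia
      have r1 := intCast_mul_completeHInt (n + 1 + j) m (by push_cast; lia)
      have r2 := intCast_mul_completeHInt (n + 1 + j) (m - j) (by push_cast; lia)
      have hm0 : (m : MvPolynomial ℕ+ ℂ) ≠ 0 := by
        rw [Ne, Int.cast_eq_zero]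
        lia
      have d1 := congrArg (MvPolynomial.pderiv j) r1
      apply mul_left_cancel₀ hm0
      have hcast : ∀ k : ℤ, MvPolynomial.pderiv j (k : MvPolynomial ℕ+ ℂ) = 0 := fun k =>
        (MvPolynomial.pderiv j).map_intCast k
      have hcast' : ∀ k : ℕ, MvPolynomial.pderiv j (k : MvPolynomial ℕ+ ℂ) = 0 := fun k =>
        (MvPolynomial.pderiv j).map_natCast k
      rw [MvPolynomial.pderiv_mul, hcast, zero_mul, zero_add, map_sum] at d1
      rw [d1]
      have hterm : ∀ a ∈ Finset.range (n + 1 + j),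
          MvPolynomial.pderiv j (((a : MvPolynomial ℕ+ ℂ) + 1) * MvPolynomial.X a.succPNat *
            completeHInt (m - (a + 1))) =
          (if a = (j : ℕ) - 1 then ((a : MvPolynomial ℕ+ ℂ) + 1) * completeHInt (m - (a + 1))
            else 0) +
          ((a : MvPolynomial ℕ+ ℂ) + 1) * MvPolynomial.X a.succPNat *
            completeHInt (m - j - (a + 1)) := by
        intro a _
        rw [MvPolynomial.pderiv_mul, MvPolynomial.pderiv_mul, map_add, hcast',
          MvPolynomial.pderiv_one, ih (m - (a + 1)) (by lia), MvPolynomial.pderiv_X]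
        have hiff : a.succPNat = j ↔ a = (j : ℕ) - 1 := by
          rw [← PNat.coe_inj, Nat.succPNat_coe]
          have := j.pos
          lia
        have e : m - (a + 1) - j = m - j - (a + 1) := by ring
        rw [e]
        by_cases h : a = (j : ℕ) - 1
        · rw [if_pos h, hiff.2 h, Pi.single_eq_same]
          ring
        · rw [if_neg h, Pi.single_eq_of_ne (fun h' => h (hiff.1 h'))]
          ring
      rw [Finset.sum_congr rfl hterm, Finset.sum_add_distrib, ← r2, Finset.sum_ite_eq',
        if_pos (by have := j.pos; simp; lia)]
      have e1 : (((j : ℕ) - 1 : ℕ) : MvPolynomial ℕ+ ℂ) + 1 = ((j : ℕ) : MvPolynomial ℕ+ ℂ) := by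
        have := j.pos
        rw [← Nat.cast_succ]
        congr 1
        lia
      have e2 : m - ((((j : ℕ) - 1 : ℕ) : ℤ) + 1) = m - j := by
        have := j.pos
        lia
      rw [e1, e2]
      push_cast
      ring
  exact key m.toNat m (by lia)

end CompleteH

/-! ### Values of the complete symmetric functions at summable parameters -/

/-- The complete symmetric function of integer index, evaluated at `t`. -/
def hVal (t : ℕ+ → ℂ) (m : ℤ) : ℂ := MvPolynomial.eval t (completeHInt m)

theorem hVal_of_neg (t : ℕ+ → ℂ) {m : ℤ} (hm : m < 0) : hVal t m = 0 := by
  simp [hVal, completeHInt_of_neg hm]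

theorem hVal_zero (t : ℕ+ → ℂ) : hVal t 0 = 1 := by
  simp [hVal, completeHInt_zero]

theorem coeff_hSeries (t : ℕ+ → ℂ) (n : ℕ) : PowerSeries.coeff n (hSeries t) = hVal t n := by
  rw [hSeries, PowerSeries.coeff_mk, hVal, completeHInt_natCast, MvPolynomial.aeval_eq_eval]

theorem flowSeries_neg (t : ℕ+ → ℂ) : flowSeries (-t) = -flowSeries t := by
  ext i
  simp only [flowSeries, PowerSeries.coeff_mk, map_neg, Pi.neg_apply]
  split_ifs <;> simp

theorem hSeries_neg_mul (t : ℕ+ → ℂ) : hSeries (-t) * hSeries t = 1 := by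
  apply PowerSeries.derivative.ext
  · rw [Derivation.leibniz, derivative_hSeries, derivative_hSeries, flowSeries_neg]
    simp only [smul_eq_mul, map_neg, PowerSeries.derivative_one]
    ring
  · rw [map_mul, ← PowerSeries.coeff_zero_eq_constantCoeff_apply,
      ← PowerSeries.coeff_zero_eq_constantCoeff_apply, coeff_zero_hSeries, coeff_zero_hSeries]
    simp

theorem sum_hVal_neg_mul_hVal (t : ℕ+ → ℂ) (n : ℕ) :
    ∑ p ∈ Finset.HasAntidiagonal.antidiagonal n, hVal (-t) p.1 * hVal t p.2 =
      if n = 0 then 1 else 0 := by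
  have := congrArg (PowerSeries.coeff n) (hSeries_neg_mul t)
  rw [PowerSeries.coeff_mul, PowerSeries.coeff_one] at this
  simpa only [coeff_hSeries] using this

theorem hVal_recursion (t : ℕ+ → ℂ) (n : ℕ) :
    hVal t n * n = ∑ p ∈ Finset.HasAntidiagonal.antidiagonal n,
      hVal t p.1 * (p.2 * PowerSeries.coeff p.2 (flowSeries t)) := by
  cases n with
  | zero => simp
  | succ n =>
    have h := congrArg (PowerSeries.coeff n) (derivative_hSeries t)
    rw [PowerSeries.coeff_derivative, PowerSeries.coeff_mul, coeff_hSeries] at h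
    rw [Finset.Nat.sum_antidiagonal_succ']
    simp only [PowerSeries.coeff_derivative, coeff_hSeries] at h
    push_cast at h ⊢
    rw [h]
    simp only [zero_mul, mul_zero, zero_add]
    refine Finset.sum_congr rfl fun p _ => ?_
    ring

theorem hasSum_pnat_iff {E : Type*} [AddCommMonoid E] [TopologicalSpace E] {g : ℕ → E}
    (h0 : g 0 = 0) {a : E} : HasSum (fun i : ℕ+ => g i) a ↔ HasSum g a := by
  refine PNat.coe_injective.hasSum_iff (f := g) ?_
  intro n hn
  rcases Nat.eq_zero_or_pos n with rfl | h
  · exact h0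
  · exact absurd ⟨⟨n, h⟩, rfl⟩ hn

/-- Powers of an absolutely summable power series are absolutely summable, and can be evaluated
on the closed unit disc. -/
theorem summable_coeff_pow {f : PowerSeries ℂ} (hf : Summable fun n => ‖PowerSeries.coeff n f‖)
    {z : ℂ} (hz : ‖z‖ ≤ 1) (k : ℕ) :
    (Summable fun n => ‖PowerSeries.coeff n (f ^ k)‖) ∧
    ∑' n, ‖PowerSeries.coeff n (f ^ k)‖ ≤ (∑' n, ‖PowerSeries.coeff n f‖) ^ k ∧
    ∑' n, PowerSeries.coeff n (f ^ k) * z ^ n = (∑' n, PowerSeries.coeff n f * z ^ n) ^ k := by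
  have hz' : ∀ g : PowerSeries ℂ, Summable (fun n => ‖PowerSeries.coeff n g‖) →
      Summable fun n => ‖PowerSeries.coeff n g * z ^ n‖ := by
    intro g hg
    refine Summable.of_nonneg_of_le (fun _ => norm_nonneg _) (fun n => ?_) hg
    rw [norm_mul, norm_pow]
    exact mul_le_of_le_one_right (norm_nonneg _) (pow_le_one₀ (norm_nonneg _) hz)
  induction k with
  | zero =>
    have h1 : ∀ n, n ∉ ({0} : Finset ℕ) → ‖PowerSeries.coeff n (f ^ 0)‖ = 0 := by
      intro n hn
      simp only [Finset.mem_singleton] at hn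
      simp [PowerSeries.coeff_one, hn]
    have h2 : ∀ n, n ∉ ({0} : Finset ℕ) → PowerSeries.coeff n (f ^ 0) * z ^ n = 0 := by
      intro n hn
      simp only [Finset.mem_singleton] at hn
      simp [PowerSeries.coeff_one, hn]
    refine ⟨(hasSum_sum_of_ne_finset_zero h1).summable, ?_, ?_⟩
    · rw [(hasSum_sum_of_ne_finset_zero h1).tsum_eq]
      simp
    · rw [(hasSum_sum_of_ne_finset_zero h2).tsum_eq]
      simp
  | succ k ih =>
    obtain ⟨i1, i2, i3⟩ := ih
    have hn1 : Summable fun n => ‖‖PowerSeries.coeff n (f ^ k)‖‖ := by simpa using i1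
    have hn2 : Summable fun n => ‖‖PowerSeries.coeff n f‖‖ := by simpa using hf
    have hs := summable_norm_sum_mul_antidiagonal_of_summable_norm i1 hf
    have hs' := (summable_norm_sum_mul_antidiagonal_of_summable_norm hn1 hn2).of_norm
    simp_rw [← PowerSeries.coeff_mul, ← pow_succ] at hs
    refine ⟨hs, ?_, ?_⟩
    · calc ∑' n, ‖PowerSeries.coeff n (f ^ (k + 1))‖ ≤
          ∑' n, ∑ p ∈ Finset.HasAntidiagonal.antidiagonal n,
            ‖PowerSeries.coeff p.1 (f ^ k)‖ * ‖PowerSeries.coeff p.2 f‖ := by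
            refine hs.tsum_le_tsum (fun n => ?_) hs'
            rw [pow_succ, PowerSeries.coeff_mul]
            refine (norm_sum_le _ _).trans (le_of_eq ?_)
            simp
        _ = (∑' n, ‖PowerSeries.coeff n (f ^ k)‖) * ∑' n, ‖PowerSeries.coeff n f‖ :=
            (tsum_mul_tsum_eq_tsum_sum_antidiagonal_of_summable_norm hn1 hn2).symm
        _ ≤ _ := by
            rw [pow_succ]
            gcongr
    · rw [pow_succ f, pow_succ (∑' n, _), ← i3,
        tsum_mul_tsum_eq_tsum_sum_antidiagonal_of_summable_norm (hz' _ i1) (hz' _ hf)]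
      refine tsum_congr fun n => ?_
      rw [PowerSeries.coeff_mul, Finset.sum_mul]
      refine Finset.sum_congr rfl fun p hp => ?_
      rw [← Finset.HasAntidiagonal.mem_antidiagonal.1 hp, pow_add]
      ring

theorem summable_coeff_flowSeries {t : ℕ+ → ℂ} (ht : Summable fun i => ‖t i‖) :
    HasSum (fun n => ‖PowerSeries.coeff n (flowSeries t)‖) (∑' i, ‖t i‖) := by
  rw [← hasSum_pnat_iff (by simp [coeff_flowSeries_zero])]
  simp_rw [coeff_flowSeries_pnat]
  exact ht.hasSum

/-- For `∑ |tᵢ| < ∞` the expansion `exp (∑ tᵢ zⁱ) = ∑ h_n(t) zⁿ` holds on the closed unit disc. -/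
theorem hVal_summable_and_hasSum {t : ℕ+ → ℂ} (ht : Summable fun i => ‖t i‖) {z : ℂ}
    (hz : ‖z‖ ≤ 1) :
    (Summable fun n : ℕ => ‖hVal t n‖) ∧
    ∑' n : ℕ, ‖hVal t n‖ ≤ Real.exp (∑' i, ‖t i‖) ∧
    HasSum (fun n : ℕ => hVal t n * z ^ n) (Complex.exp (∑' i : ℕ+, t i * z ^ (i : ℕ))) := by
  set T := flowSeries t with hT
  have hTs := summable_coeff_flowSeries ht
  have hpow := summable_coeff_pow hTs.summable hz
  rw [hTs.tsum_eq] at hpow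
  set S := ∑' i, ‖t i‖ with hS
  have hSexp : HasSum (fun k : ℕ => S ^ k / (k.factorial : ℝ)) (Real.exp S) := by
    rw [Real.exp_eq_exp_ℝ]
    exact NormedSpace.expSeries_div_hasSum_exp S
  -- the coefficients of the terms `T^k / k!`, an absolutely summable double family
  let F : ℕ × ℕ → ℂ := fun p => PowerSeries.coeff p.2 (T ^ p.1) / (p.1.factorial : ℂ)
  have hFn : ∀ k, ∑' n, ‖F (k, n)‖ = (∑' n, ‖PowerSeries.coeff n (T ^ k)‖) / k.factorial := by
    intro k
    simp only [F, norm_div, Complex.norm_natCast]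
    exact tsum_div_const
  have hFle : ∀ k, ∑' n, ‖F (k, n)‖ ≤ S ^ k / k.factorial := by
    intro k
    rw [hFn]
    have := (hpow k).2.1
    gcongr
  have hFs : Summable fun p => ‖F p‖ := by
    rw [summable_prod_of_nonneg (fun _ => norm_nonneg _)]
    refine ⟨fun k => ?_, ?_⟩
    · simp only [F, norm_div, Complex.norm_natCast]
      exact (hpow k).1.div_const _
    · exact Summable.of_nonneg_of_le (fun _ => tsum_nonneg fun _ => norm_nonneg _) hFle
        hSexp.summable
  have hh : ∀ n : ℕ, hVal t n = ∑' k, F (k, n) := by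
    intro n
    rw [← coeff_hSeries, hSeries_eq_subst, PowerSeries.coeff_subst' (hasSubst_flowSeries t),
      ← tsum_eq_finsum (L := .unconditional ℕ)
        (PowerSeries.coeff_subst_finite' (hasSubst_flowSeries t) _ n)]
    refine tsum_congr fun k => ?_
    simp [F, PowerSeries.coeff_exp, hT]
    ring
  have hFsw : Summable fun p : ℕ × ℕ => ‖F p.swap‖ := hFs.prod_symm
  have hle : ∀ n : ℕ, ‖hVal t n‖ ≤ ∑' k, ‖F (k, n)‖ := by
    intro n
    rw [hh]
    exact norm_tsum_le_tsum_norm (hFsw.prod_factor n)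
  have hsum : Summable fun n : ℕ => ‖hVal t n‖ :=
    Summable.of_nonneg_of_le (fun _ => norm_nonneg _) hle hFsw.prod
  refine ⟨hsum, ?_, ?_⟩
  · calc ∑' n : ℕ, ‖hVal t n‖ ≤ ∑' n, ∑' k, ‖F (k, n)‖ := hsum.tsum_le_tsum hle hFsw.prod
      _ = ∑' k, ∑' n, ‖F (k, n)‖ := Summable.tsum_comm (f := fun k n => ‖F (k, n)‖) hFs
      _ ≤ ∑' k : ℕ, S ^ k / k.factorial := hFs.prod.tsum_le_tsum hFle hSexp.summable
      _ = _ := hSexp.tsum_eq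
  · have hG : Summable fun p : ℕ × ℕ => F p * z ^ p.2 := by
      refine Summable.of_norm_bounded hFs fun p => ?_
      rw [norm_mul, norm_pow]
      exact mul_le_of_le_one_right (norm_nonneg _) (pow_le_one₀ (norm_nonneg _) hz)
    have hG' : Summable fun p : ℕ × ℕ => F p.swap * z ^ p.1 := hG.prod_symm
    have e1 : ∀ n : ℕ, hVal t n * z ^ n = ∑' k, F (k, n) * z ^ n := by
      intro n
      rw [hh, tsum_mul_right]
    have hsn : Summable fun n : ℕ => hVal t n * z ^ n := by
      simp_rw [e1]
      exact hG'.prod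
    have e2 : ∑' n : ℕ, hVal t n * z ^ n = Complex.exp (∑' i : ℕ+, t i * z ^ (i : ℕ)) := by
      simp_rw [e1]
      rw [Summable.tsum_comm (f := fun k n => F (k, n) * z ^ n) hG]
      have e3 : ∀ k : ℕ, ∑' n, F (k, n) * z ^ n =
          (∑' n, PowerSeries.coeff n T * z ^ n) ^ k / k.factorial := by
        intro k
        rw [← (hpow k).2.2, ← tsum_div_const]
        refine tsum_congr fun n => ?_
        simp only [F]
        ring
      have e4 : ∑' n, PowerSeries.coeff n T * z ^ n = ∑' i : ℕ+, t i * z ^ (i : ℕ) := by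
        have hs : Summable fun n => PowerSeries.coeff n T * z ^ n := by
          refine Summable.of_norm_bounded hTs.summable fun n => ?_
          rw [norm_mul, norm_pow]
          exact mul_le_of_le_one_right (norm_nonneg _) (pow_le_one₀ (norm_nonneg _) hz)
        have := (hasSum_pnat_iff (g := fun n => PowerSeries.coeff n T * z ^ n)
          (by simp [hT, coeff_flowSeries_zero])).2 hs.hasSum
        simp only [hT, coeff_flowSeries_pnat] at this
        exact this.tsum_eq.symm
      simp_rw [e3, e4]
      rw [Complex.exp_eq_exp_ℂ]
      exact (NormedSpace.expSeries_div_hasSum_exp _).tsum_eq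
    rw [← e2]
    exact hsn.hasSum

/-- The Hankel block of multiplication by `exp (∑ tᵢ zⁱ)` is Hilbert–Schmidt:
`∑ n |h_n|²` is finite. By the recursion `n h_n = ∑ i tᵢ h_{n-i}`, the sequence `√n |h_n|` is
dominated by the convolution of `√i |tᵢ|` with `|h_j|`. -/
theorem summable_mul_hVal_sq {t : ℕ+ → ℂ} (ht : IsFlowParam t) :
    (Summable fun n : ℕ => (n : ℝ) * ‖hVal t n‖ ^ 2) ∧
    ∑' n : ℕ, (n : ℝ) * ‖hVal t n‖ ^ 2 ≤
      Real.exp (∑' i, ‖t i‖) ^ 2 * ∑' i : ℕ+, (i : ℝ) * ‖t i‖ ^ 2 := by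
  obtain ⟨hs, hle, -⟩ := hVal_summable_and_hasSum ht.1 (z := 0) (by simp)
  set G := ∑' n : ℕ, ‖hVal t n‖ with hG
  have hG0 : 0 ≤ G := tsum_nonneg fun _ => norm_nonneg _
  set u : ℕ → ℝ := fun n => n * ‖PowerSeries.coeff n (flowSeries t)‖ ^ 2 with hu
  have hus : HasSum u (∑' i : ℕ+, (i : ℝ) * ‖t i‖ ^ 2) := by
    rw [← hasSum_pnat_iff (by simp [hu])]
    simp only [hu, coeff_flowSeries_pnat]
    exact ht.2.hasSum
  have hu0 : ∀ n, 0 ≤ u n := fun n => by positivity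
  have hn1 : Summable fun n : ℕ => ‖‖hVal t n‖‖ := by simpa using hs
  have hn2 : Summable fun n : ℕ => ‖u n‖ := by
    simpa only [Real.norm_eq_abs, abs_of_nonneg (hu0 _)] using hus.summable
  have hconv := (summable_norm_sum_mul_antidiagonal_of_summable_norm hn1 hn2).of_norm
  have hpt : ∀ n : ℕ, (n : ℝ) * ‖hVal t n‖ ^ 2 ≤
      G * ∑ p ∈ Finset.HasAntidiagonal.antidiagonal n, ‖hVal t p.1‖ * u p.2 := by
    intro n
    rcases Nat.eq_zero_or_pos n with rfl | hn
    · simp [hu]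
    have hn' : (0 : ℝ) < n := by exact_mod_cast hn
    set v : ℕ → ℝ := fun i => i * ‖PowerSeries.coeff i (flowSeries t)‖ with hv
    have h1 : ‖hVal t n‖ * n ≤
        ∑ p ∈ Finset.HasAntidiagonal.antidiagonal n, ‖hVal t p.1‖ * v p.2 := by
      have := congrArg norm (hVal_recursion t n)
      rw [norm_mul, Complex.norm_natCast] at this
      rw [this]
      refine (norm_sum_le _ _).trans (le_of_eq ?_)
      simp [hv]
    have h2 : (∑ p ∈ Finset.HasAntidiagonal.antidiagonal n, ‖hVal t p.1‖ * v p.2) ^ 2 ≤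
        (∑ p ∈ Finset.HasAntidiagonal.antidiagonal n, ‖hVal t p.1‖) *
          ∑ p ∈ Finset.HasAntidiagonal.antidiagonal n, ‖hVal t p.1‖ * v p.2 ^ 2 := by
      refine Finset.sum_sq_le_sum_mul_sum_of_sq_le_mul _ (fun _ _ => norm_nonneg _)
        (fun _ _ => by positivity) fun p _ => le_of_eq ?_
      ring
    have h3 : ∑ p ∈ Finset.HasAntidiagonal.antidiagonal n, ‖hVal t p.1‖ ≤ G := by
      rw [Finset.Nat.sum_antidiagonal_eq_sum_range_succ (fun (i : ℕ) _ => ‖hVal t i‖)]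
      exact hs.sum_le_tsum _ fun _ _ => norm_nonneg _
    have h4 : ∑ p ∈ Finset.HasAntidiagonal.antidiagonal n, ‖hVal t p.1‖ * v p.2 ^ 2 ≤
        n * ∑ p ∈ Finset.HasAntidiagonal.antidiagonal n, ‖hVal t p.1‖ * u p.2 := by
      rw [Finset.mul_sum]
      refine Finset.sum_le_sum fun p hp => ?_
      have hp2 : (p.2 : ℝ) ≤ n := by
        have := Finset.HasAntidiagonal.mem_antidiagonal.1 hp
        exact_mod_cast (by lia : p.2 ≤ n)
      have : v p.2 ^ 2 = p.2 * u p.2 := by simp only [hv, hu]; ring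
      rw [this]
      have := hu0 p.2
      calc ‖hVal t p.1‖ * (p.2 * u p.2) ≤ ‖hVal t p.1‖ * (n * u p.2) := by gcongr
        _ = _ := by ring
    have h0 : 0 ≤ ∑ p ∈ Finset.HasAntidiagonal.antidiagonal n, ‖hVal t p.1‖ * v p.2 ^ 2 :=
      Finset.sum_nonneg fun _ _ => by positivity
    have h5 : (‖hVal t n‖ * n) ^ 2 ≤
        G * (n * ∑ p ∈ Finset.HasAntidiagonal.antidiagonal n, ‖hVal t p.1‖ * u p.2) :=
      calc (‖hVal t n‖ * n) ^ 2 ≤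
            (∑ p ∈ Finset.HasAntidiagonal.antidiagonal n, ‖hVal t p.1‖ * v p.2) ^ 2 := by
            gcongr
        _ ≤ _ := h2
        _ ≤ _ := mul_le_mul h3 h4 h0 hG0
    have h6 : (n : ℝ) * (n * ‖hVal t n‖ ^ 2) ≤
        n * (G * ∑ p ∈ Finset.HasAntidiagonal.antidiagonal n, ‖hVal t p.1‖ * u p.2) := by
      nlinarith [h5]
    exact le_of_mul_le_mul_left h6 hn'
  have hsum : Summable fun n : ℕ => (n : ℝ) * ‖hVal t n‖ ^ 2 :=
    Summable.of_nonneg_of_le (fun _ => by positivity) hpt (hconv.mul_left G)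
  refine ⟨hsum, ?_⟩
  calc ∑' n : ℕ, (n : ℝ) * ‖hVal t n‖ ^ 2 ≤
      ∑' n : ℕ, G * ∑ p ∈ Finset.HasAntidiagonal.antidiagonal n, ‖hVal t p.1‖ * u p.2 :=
        hsum.tsum_le_tsum hpt (hconv.mul_left G)
    _ = G * (G * ∑' i : ℕ+, (i : ℝ) * ‖t i‖ ^ 2) := by
        rw [tsum_mul_left, ← tsum_mul_tsum_eq_tsum_sum_antidiagonal_of_summable_norm hn1 hn2,
          hus.tsum_eq]
    _ = G ^ 2 * ∑' i : ℕ+, (i : ℝ) * ‖t i‖ ^ 2 := by ring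
    _ ≤ _ := by
        have : 0 ≤ ∑' i : ℕ+, (i : ℝ) * ‖t i‖ ^ 2 := tsum_nonneg fun _ => by positivity
        gcongr

/-! ### Young diagrams in a rectangle and maximal minors -/

theorem orderEmbedding_add_sub_le {N K : ℕ} (g : Fin N ↪o Fin K) :
    ∀ a b : Fin N, a ≤ b → (g a : ℕ) + (b - a) ≤ g b := by
  have key : ∀ d : ℕ, ∀ a b : Fin N, (b : ℕ) = a + d → (g a : ℕ) + d ≤ g b := by
    intro d
    induction d with
    | zero =>
      intro a b h
      have : a = b := Fin.ext (by simpa using h.symm)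
      simp [this]
    | succ d ih =>
      intro a b h
      have hb := b.2
      have h1 := ih a ⟨a + d, by lia⟩ rfl
      have h2 : g ⟨a + d, by lia⟩ < g b := g.strictMono (by rw [Fin.lt_def]; simp; lia)
      rw [Fin.lt_def] at h2
      lia
  intro a b hab
  exact key _ a b (by rw [Fin.le_def] at hab; lia)

theorem orderEmbedding_le_add {N M : ℕ} (g : Fin N ↪o Fin (N + M)) (i : Fin N) :
    (g i : ℕ) ≤ M + i := by
  have hi := i.2
  have h := orderEmbedding_add_sub_le g i ⟨N - 1, by lia⟩ (by rw [Fin.le_def]; simp; lia)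
  have h2 := (g ⟨N - 1, by lia⟩).2
  simp only at h
  lia

theorem le_orderEmbedding {N K : ℕ} (g : Fin N ↪o Fin K) (i : Fin N) : (i : ℕ) ≤ g i := by
  have hi := i.2
  have h := orderEmbedding_add_sub_le g ⟨0, by lia⟩ i (by rw [Fin.le_def]; simp)
  simp only at h
  lia

/-- The diagram `λ` in the `N × M` rectangle that belongs to the increasing sequence
`g k = M + k - λ_k`, `k = 0, …, N - 1`, of elements of `{0, …, N + M - 1}`. -/
def boxDiagram {N M : ℕ} (g : Fin N ↪o Fin (N + M)) : YoungDiagram where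
  cells := (Finset.range N ×ˢ Finset.range M).filter fun c =>
    ∃ h : c.1 < N, c.2 + g ⟨c.1, h⟩ < M + c.1
  isLowerSet := by
    rintro ⟨i, j⟩ ⟨i', j'⟩ ⟨hi, hj⟩ hc
    simp only [Finset.coe_filter, Finset.mem_product, Finset.mem_range, Set.mem_ofPred_eq] at hc ⊢
    simp only at hi hj
    obtain ⟨⟨h1, h2⟩, h3, h4⟩ := hc
    have := orderEmbedding_add_sub_le g ⟨i', by lia⟩ ⟨i, h3⟩ hi
    simp only at this
    exact ⟨⟨by lia, by lia⟩, by lia, by lia⟩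

theorem mem_boxDiagram {N M : ℕ} (g : Fin N ↪o Fin (N + M)) (i j : ℕ) :
    (i, j) ∈ boxDiagram g ↔ ∃ h : i < N, j + g ⟨i, h⟩ < M + i := by
  rw [← YoungDiagram.mem_cells, boxDiagram]
  simp only [Finset.mem_filter, Finset.mem_product, Finset.mem_range, and_iff_right_iff_imp]
  rintro ⟨h, h'⟩
  have := le_orderEmbedding g ⟨i, h⟩
  simp only at this
  exact ⟨h, by lia⟩

theorem rowLen_boxDiagram {N M : ℕ} (g : Fin N ↪o Fin (N + M)) (i : Fin N) :
    (boxDiagram g).rowLen i + g i = M + i := by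
  have h := orderEmbedding_le_add g i
  have : (boxDiagram g).rowLen i = M + i - g i := by
    refine eq_of_forall_lt_iff fun j => ?_
    rw [← YoungDiagram.mem_iff_lt_rowLen, mem_boxDiagram]
    simp only [i.2, exists_true_left, Fin.eta]
    lia
  lia

theorem boxDiagram_injective {N M : ℕ} :
    Function.Injective (boxDiagram : (Fin N ↪o Fin (N + M)) → YoungDiagram) := by
  intro g g' h
  ext i
  have h1 := rowLen_boxDiagram g i
  have h2 := rowLen_boxDiagram g' i
  rw [h] at h1
  lia

/-- The Young diagrams contained in the `N × M` rectangle. -/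
def box (N M : ℕ) : Finset YoungDiagram :=
  Finset.univ.map ⟨boxDiagram (N := N) (M := M), boxDiagram_injective⟩

theorem sum_box {E : Type*} [AddCommMonoid E] {N M : ℕ} (F : YoungDiagram → E) :
    ∑ μ ∈ box N M, F μ = ∑ g : Fin N ↪o Fin (N + M), F (boxDiagram g) := by
  rw [box, Finset.sum_map]
  rfl

theorem rowLen_eq_zero_iff {μ : YoungDiagram} {i : ℕ} : μ.rowLen i = 0 ↔ μ.colLen 0 ≤ i := by
  rw [← not_lt, ← YoungDiagram.mem_iff_lt_colLen, YoungDiagram.mem_iff_lt_rowLen]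
  lia

theorem youngDiagram_ext {μ ν : YoungDiagram} (h : ∀ i, μ.rowLen i = ν.rowLen i) : μ = ν := by
  ext ⟨i, j⟩
  rw [YoungDiagram.mem_cells, YoungDiagram.mem_cells, YoungDiagram.mem_iff_lt_rowLen,
    YoungDiagram.mem_iff_lt_rowLen, h]

theorem mem_box {N M : ℕ} {μ : YoungDiagram} :
    μ ∈ box N M ↔ μ.colLen 0 ≤ N ∧ μ.rowLen 0 ≤ M := by
  constructor
  · intro h
    obtain ⟨g, -, rfl⟩ := Finset.mem_map.1 h
    simp only [Function.Embedding.coeFn_mk]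
    constructor
    · by_contra! hN
      rw [← YoungDiagram.mem_iff_lt_colLen, mem_boxDiagram] at hN
      obtain ⟨h, -⟩ := hN
      lia
    · by_contra! hM
      rw [← YoungDiagram.mem_iff_lt_rowLen, mem_boxDiagram] at hM
      obtain ⟨h, h'⟩ := hM
      lia
  · rintro ⟨hN, hM⟩
    have hle : ∀ i, μ.rowLen i ≤ M := fun i => (μ.rowLen_anti 0 i (Nat.zero_le _)).trans hM
    let g : Fin N ↪o Fin (N + M) := OrderEmbedding.ofStrictMono
      (fun i => ⟨M + i - μ.rowLen i, by have := i.2; lia⟩) (by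
        intro a b hab
        rw [Fin.lt_def] at hab ⊢
        have := μ.rowLen_anti a b hab.le
        have := hle a
        simp only
        lia)
    refine Finset.mem_map.2 ⟨g, Finset.mem_univ _, ?_⟩
    simp only [Function.Embedding.coeFn_mk]
    refine youngDiagram_ext fun i => ?_
    by_cases hi : i < N
    · have h1 := rowLen_boxDiagram g ⟨i, hi⟩
      have h2 : (g ⟨i, hi⟩ : ℕ) = M + i - μ.rowLen i := rfl
      have := hle i
      simp only at h1
      lia
    · have h1 : μ.rowLen i = 0 := rowLen_eq_zero_iff.2 (by lia)
      rw [h1, rowLen_eq_zero_iff]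
      by_contra! h
      rw [← YoungDiagram.mem_iff_lt_colLen, mem_boxDiagram] at h
      obtain ⟨h, -⟩ := h
      exact hi h

theorem exists_subset_box (s : Finset YoungDiagram) : ∃ K, ∀ N M, K ≤ N → K ≤ M → s ⊆ box N M := by
  refine ⟨s.sup fun μ => max (μ.colLen 0) (μ.rowLen 0), fun N M hN hM μ hμ => ?_⟩
  have := Finset.le_sup (f := fun μ : YoungDiagram => max (μ.colLen 0) (μ.rowLen 0)) hμ
  rw [mem_box]
  lia

/-- Jacobi–Trudi determinants may be computed with any number of rows `N ≥ ℓ(λ)`. -/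
theorem schur_eq_det {μ : YoungDiagram} {N : ℕ} (hN : μ.colLen 0 ≤ N) :
    schur μ = (Matrix.of fun i j : Fin N =>
      completeHInt ((μ.rowLen i : ℤ) - (i : ℤ) + (j : ℤ))).det := by
  induction N, hN using Nat.le_induction with
  | base => rfl
  | succ N hN ih =>
    have hrow : μ.rowLen N = 0 := rowLen_eq_zero_iff.2 hN
    rw [Matrix.det_succ_row _ (Fin.last N), Finset.sum_eq_single (Fin.last N)]
    · have h1 : completeHInt ((μ.rowLen N : ℤ) - N + N) = 1 := by
        rw [hrow]
        simpa using completeHInt_zero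
      simp only [Matrix.of_apply, Fin.val_last, h1]
      rw [ih]
      have hs : (-1 : MvPolynomial ℕ+ ℂ) ^ (N + N) = 1 := Even.neg_one_pow ⟨N, rfl⟩
      rw [hs, one_mul, one_mul]
      congr 1
      ext1 i j
      simp [Matrix.submatrix_apply]
    · intro j _ hj
      have : (j : ℕ) < N := Fin.val_lt_last hj
      simp only [Matrix.of_apply, Fin.val_last]
      rw [hrow, completeHInt_of_neg (by push_cast; lia)]
      ring
    · simp

/-! ### Minors of the flow and of the frame -/

/-- Rows `z⁰, …, z^{N-1}` and columns `z^{-M}, …, z^{N-1}` of the matrix of multiplication by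
`exp (∑ tᵢ zⁱ)`. -/
def flowBlock (t : ℕ+ → ℂ) (N M : ℕ) : Matrix (Fin N) (Fin (N + M)) ℂ :=
  Matrix.of fun n c => hVal t ((n : ℤ) - ((c : ℤ) - M))

/-- Rows `z^{-M}, …, z^{N-1}` of the first `N` columns of a matrix indexed by exponents. -/
def frameBlock (V : ℤ → ℕ → ℂ) (N M : ℕ) : Matrix (Fin (N + M)) (Fin N) ℂ :=
  Matrix.of fun c j => V ((c : ℤ) - M) j

/-- The leading `N × N` minor of the rows `z^{k - λ_k}`, `k = 0, 1, …`, of a matrix indexed by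
exponents. -/
def frameMinor (V : ℤ → ℕ → ℂ) (N : ℕ) (μ : YoungDiagram) : ℂ :=
  (Matrix.of fun k j : Fin N => V ((k : ℤ) - μ.rowLen k) j).det

/-- The maximal minors of the flow block are Schur functions, by the Jacobi–Trudi definition. -/
theorem det_flowBlock_submatrix (t : ℕ+ → ℂ) {N M : ℕ} (g : Fin N ↪o Fin (N + M)) :
    ((flowBlock t N M).submatrix id g).det = MvPolynomial.eval t (schur (boxDiagram g)) := by
  have hN : (boxDiagram g).colLen 0 ≤ N :=
    (mem_box.1 (Finset.mem_map.2 ⟨g, Finset.mem_univ _, rfl⟩)).1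
  rw [schur_eq_det hN, RingHom.map_det, ← Matrix.det_transpose]
  congr 1
  ext k n
  have h := rowLen_boxDiagram g k
  simp only [Matrix.transpose_apply, Matrix.submatrix_apply, flowBlock, Matrix.of_apply, id,
    RingHom.mapMatrix_apply, Matrix.map_apply, hVal]
  congr 2
  lia

theorem det_frameBlock_submatrix (V : ℤ → ℕ → ℂ) {N M : ℕ} (g : Fin N ↪o Fin (N + M)) :
    ((frameBlock V N M).submatrix g id).det = frameMinor V N (boxDiagram g) := by
  rw [frameMinor]
  congr 1
  ext k n
  have h := rowLen_boxDiagram g k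
  simp only [Matrix.submatrix_apply, frameBlock, Matrix.of_apply, id]
  congr 1
  lia

theorem det_flowBlock_mul_frameBlock (t : ℕ+ → ℂ) (V : ℤ → ℕ → ℂ) (N M : ℕ) :
    (flowBlock t N M * frameBlock V N M).det =
      ∑ μ ∈ box N M, frameMinor V N μ * MvPolynomial.eval t (schur μ) := by
  rw [det_mul_eq_sum_orderEmbedding, sum_box]
  refine Finset.sum_congr rfl fun g _ => ?_
  rw [det_flowBlock_submatrix, det_frameBlock_submatrix, mul_comm]

/-! ### Square summability of the Schur functions -/

/-- A bound on the absolute row and column sums of the Toeplitz matrix of the `h_n(t)`. -/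
theorem sum_norm_hVal_comp_le {t : ℕ+ → ℂ} (ht : Summable fun i => ‖t i‖) {ι : Type*} [Fintype ι]
    (φ : ι → ℤ) (hφ : Function.Injective φ) :
    ∑ i, ‖hVal t (φ i)‖ ≤ Real.exp (∑' i, ‖t i‖) := by
  obtain ⟨h1, h2, -⟩ := hVal_summable_and_hasSum ht (z := 0) (by simp)
  have h3 : HasSum (fun m : ℤ => ‖hVal t m‖) (∑' n : ℕ, ‖hVal t n‖) := by
    refine (Nat.cast_injective (R := ℤ)).hasSum_iff (f := fun m : ℤ => ‖hVal t m‖) ?_ |>.1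
      h1.hasSum
    intro m hm
    have : m < 0 := by
      by_contra! h
      exact hm ⟨m.toNat, by simp [h]⟩
    simp [hVal_of_neg t this]
  refine le_trans (le_of_eq (Finset.sum_map Finset.univ ⟨φ, hφ⟩ (fun m => ‖hVal t m‖)).symm) ?_
  refine le_trans ?_ h2
  rw [← h3.tsum_eq]
  exact h3.summable.sum_le_tsum _ fun _ _ => norm_nonneg _

/-- The truncated Toeplitz matrix of the `h_n(-t)` inverts that of the `h_n(t)`; truncation does no
harm because both are triangular. -/
theorem sum_hVal_neg_mul_hVal_fin (t : ℕ+ → ℂ) {N : ℕ} (n : Fin N) (m : ℕ) :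
    ∑ p : Fin N, hVal (-t) ((n : ℤ) - p) * hVal t ((p : ℤ) - m) =
      if (n : ℕ) = m then 1 else 0 := by
  have hn := n.2
  rcases lt_or_ge (n : ℕ) m with h | h
  · rw [if_neg h.ne, Finset.sum_eq_zero]
    intro p _
    rcases lt_or_ge (n : ℕ) p with h' | h'
    · rw [hVal_of_neg _ (by lia), zero_mul]
    · rw [hVal_of_neg t (by lia), mul_zero]
  · rw [Fin.sum_univ_eq_sum_range (fun p => hVal (-t) ((n : ℤ) - p) * hVal t ((p : ℤ) - m)) N]
    have := sum_hVal_neg_mul_hVal t (n - m)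
    have h0 : (n : ℕ) - m = 0 ↔ (n : ℕ) = m := by lia
    simp only [h0] at this
    rw [← this]
    symm
    refine Finset.sum_of_injOn (fun x => m + x.2) ?_ ?_ ?_ ?_
    · rintro ⟨a, b⟩ hx ⟨a', b'⟩ hx' hxy
      have e1 := Finset.HasAntidiagonal.mem_antidiagonal.1 (Finset.mem_coe.1 hx)
      have e2 := Finset.HasAntidiagonal.mem_antidiagonal.1 (Finset.mem_coe.1 hx')
      simp only at e1 e2 hxy
      ext <;> simp only <;> lia
    · rintro ⟨a, b⟩ hx
      have e1 := Finset.HasAntidiagonal.mem_antidiagonal.1 (Finset.mem_coe.1 hx)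
      simp only [Finset.coe_range, Set.mem_Iio] at e1 ⊢
      lia
    · intro p hp hp'
      rcases lt_or_ge (n : ℕ) p with h' | h'
      · rw [hVal_of_neg _ (by lia), zero_mul]
      · rcases lt_or_ge p m with h2 | h2
        · rw [hVal_of_neg t (by lia), mul_zero]
        · exfalso
          refine hp' ⟨(n - p, p - m), ?_, ?_⟩
          · rw [Finset.mem_coe, Finset.HasAntidiagonal.mem_antidiagonal]
            lia
          · simp only
            lia
    · rintro ⟨a, b⟩ hx
      have e1 := Finset.HasAntidiagonal.mem_antidiagonal.1 hx
      simp only at e1 ⊢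
      congr 2 <;> push_cast <;> lia

/-- In a Hankel matrix the entry `a n` occurs at most `n` times. -/
theorem sum_hankel_le {a : ℕ → ℝ} (ha : ∀ n, 0 ≤ a n) (hs : Summable fun n : ℕ => (n : ℝ) * a n)
    (N M : ℕ) :
    ∑ p : Fin N, ∑ q : Fin M, a (p + q + 1) ≤ ∑' n : ℕ, (n : ℝ) * a n := by
  have h0 : ∑ p : Fin N, ∑ q : Fin M, a (p + q + 1) =
      ∑ x ∈ Finset.range N ×ˢ Finset.range M, a (x.1 + x.2 + 1) := by
    rw [Finset.sum_product,
      ← Fin.sum_univ_eq_sum_range (fun p => ∑ q ∈ Finset.range M, a (p + q + 1))]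
    refine Finset.sum_congr rfl fun p _ => ?_
    rw [Fin.sum_univ_eq_sum_range (fun q => a (p + q + 1))]
  have hmaps : ∀ x ∈ Finset.range N ×ˢ Finset.range M,
      x.1 + x.2 + 1 ∈ Finset.range (N + M + 1) := by
    intro x hx
    simp only [Finset.mem_product, Finset.mem_range] at hx ⊢
    lia
  rw [h0, ← Finset.sum_fiberwise_of_maps_to hmaps]
  refine le_trans (Finset.sum_le_sum fun n _ => ?_)
    (hs.sum_le_tsum (Finset.range (N + M + 1)) fun n _ => mul_nonneg (Nat.cast_nonneg n) (ha n))
  rw [Finset.sum_congr rfl (g := fun _ => a n) (fun x hx => by rw [(Finset.mem_filter.1 hx).2]),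
    Finset.sum_const, nsmul_eq_mul]
  refine mul_le_mul_of_nonneg_right ?_ (ha n)
  have : ((Finset.range N ×ˢ Finset.range M).filter fun x => x.1 + x.2 + 1 = n).card ≤
      (Finset.range n).card := by
    refine Finset.card_le_card_of_injOn (fun x => x.1) ?_ ?_
    · intro x hx
      have := (Finset.mem_filter.1 (Finset.mem_coe.1 hx)).2
      simp only [Finset.coe_range, Set.mem_Iio]
      lia
    · intro x hx y hy hxy
      have e1 := (Finset.mem_filter.1 (Finset.mem_coe.1 hx)).2
      have e2 := (Finset.mem_filter.1 (Finset.mem_coe.1 hy)).2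
      simp only at hxy
      ext <;> lia
  rw [Finset.card_range] at this
  exact_mod_cast this

/-- A bound for `∑_λ |s_λ(t)|²`. -/
def schurBound (t : ℕ+ → ℂ) : ℝ :=
  Real.exp (Real.exp (∑' i, ‖t i‖) ^ 2 *
    (Real.exp (∑' i, ‖t i‖) ^ 2 * ∑' i : ℕ+, (i : ℝ) * ‖t i‖ ^ 2))

/-- Write the rows `z⁰, z¹, …` of multiplication by `γ(t)` as `[a, b]`. Multiplying by the
unitriangular `a⁻¹`, the Toeplitz matrix of the `h_n(-t)`, leaves the maximal minors unchanged
and produces `[1, a⁻¹ b]`, where the Hankel block `b` is Hilbert–Schmidt; Hadamard's inequality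
then bounds the sum of the squared minors. -/
theorem sum_box_norm_schur_sq_le {t : ℕ+ → ℂ} (ht : IsFlowParam t) (N M : ℕ) :
    ∑ μ ∈ box N M, ‖MvPolynomial.eval t (schur μ)‖ ^ 2 ≤ schurBound t := by
  set G := Real.exp (∑' i, ‖t i‖) with hG
  have hG0 : 0 ≤ G := (Real.exp_pos _).le
  have htn : Summable fun i => ‖(-t) i‖ := by simpa using ht.1
  have hGn : Real.exp (∑' i, ‖(-t) i‖) = G := by simp [hG]
  set L : Matrix (Fin N) (Fin N) ℂ := Matrix.of fun n p => hVal (-t) ((n : ℤ) - p) with hL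
  have hLdet : L.det = 1 := by
    rw [Matrix.det_of_isLowerTriangular]
    · simp [hL, hVal_zero]
    · intro i j hij
      rw [OrderDual.toDual_lt_toDual, Fin.lt_def] at hij
      simp only [hL, Matrix.of_apply]
      exact hVal_of_neg _ (by lia)
  set B := L * flowBlock t N M with hB
  have hminor : ∀ g : Fin N ↪o Fin (N + M),
      (B.transpose.submatrix g id).det = MvPolynomial.eval t (schur (boxDiagram g)) := by
    intro g
    have : B.transpose.submatrix g id = (L * (flowBlock t N M).submatrix id g).transpose := by
      rfl
    rw [this, Matrix.det_transpose, Matrix.det_mul, hLdet, one_mul, det_flowBlock_submatrix]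
  have hmain := sum_norm_det_submatrix_sq_le B.transpose
  rw [sum_box]
  simp_rw [hminor] at hmain
  refine hmain.trans ?_
  rw [schurBound]
  refine Real.exp_le_exp.2 ?_
  have hBapp : ∀ n c, B n c =
      ∑ p : Fin N, hVal (-t) ((n : ℤ) - p) * hVal t ((p : ℤ) - ((c : ℤ) - M)) := by
    intro n c
    simp [hB, hL, Matrix.mul_apply, flowBlock]
  -- columns `z^{-q-1}` of the product, the block `a⁻¹ b`
  have hneg : ∀ (n : Fin N) (q : Fin M),
      ‖∑ p : Fin N, hVal (-t) ((n : ℤ) - p) * hVal t ((p + q + 1 : ℕ) : ℤ)‖ ^ 2 ≤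
        G * ∑ p : Fin N, ‖hVal (-t) ((n : ℤ) - p)‖ * ‖hVal t ((p + q + 1 : ℕ) : ℤ)‖ ^ 2 := by
    intro n q
    have h1 : ‖∑ p : Fin N, hVal (-t) ((n : ℤ) - p) * hVal t ((p + q + 1 : ℕ) : ℤ)‖ ≤
        ∑ p : Fin N, ‖hVal (-t) ((n : ℤ) - p)‖ * ‖hVal t ((p + q + 1 : ℕ) : ℤ)‖ := by
      refine (norm_sum_le _ _).trans (le_of_eq ?_)
      simp only [norm_mul]
    have h2 : (∑ p : Fin N, ‖hVal (-t) ((n : ℤ) - p)‖ * ‖hVal t ((p + q + 1 : ℕ) : ℤ)‖) ^ 2 ≤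
        (∑ p : Fin N, ‖hVal (-t) ((n : ℤ) - p)‖) *
        ∑ p : Fin N, ‖hVal (-t) ((n : ℤ) - p)‖ * ‖hVal t ((p + q + 1 : ℕ) : ℤ)‖ ^ 2 :=
      Finset.sum_sq_le_sum_mul_sum_of_sq_le_mul _ (fun _ _ => norm_nonneg _)
        (fun _ _ => by positivity) fun p _ => le_of_eq (by ring)
    have h3 : ∑ p : Fin N, ‖hVal (-t) ((n : ℤ) - p)‖ ≤ G := by
      rw [← hGn]
      refine sum_norm_hVal_comp_le htn (fun p : Fin N => (n : ℤ) - p) fun a b hab => ?_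
      simp only at hab
      exact Fin.ext (by lia)
    refine (pow_le_pow_left₀ (norm_nonneg _) h1 2).trans (h2.trans ?_)
    exact mul_le_mul_of_nonneg_right h3 (Finset.sum_nonneg fun _ _ => by positivity)
  obtain ⟨hK1, hK2⟩ := summable_mul_hVal_sq ht
  have hsumneg : ∑ n : Fin N, ∑ q : Fin M,
      ‖∑ p : Fin N, hVal (-t) ((n : ℤ) - p) * hVal t ((p + q + 1 : ℕ) : ℤ)‖ ^ 2 ≤
      G ^ 2 * (G ^ 2 * ∑' i : ℕ+, (i : ℝ) * ‖t i‖ ^ 2) := by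
    calc _ ≤ ∑ n : Fin N, ∑ q : Fin M, G * ∑ p : Fin N,
          ‖hVal (-t) ((n : ℤ) - p)‖ * ‖hVal t ((p + q + 1 : ℕ) : ℤ)‖ ^ 2 :=
          Finset.sum_le_sum fun n _ => Finset.sum_le_sum fun q _ => hneg n q
      _ = G * ∑ p : Fin N, (∑ n : Fin N, ‖hVal (-t) ((n : ℤ) - p)‖) *
            ∑ q : Fin M, ‖hVal t ((p + q + 1 : ℕ) : ℤ)‖ ^ 2 := by
          simp_rw [← Finset.mul_sum]
          congr 1
          simp_rw [Finset.sum_mul, Finset.mul_sum]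
          rw [Finset.sum_congr rfl fun n _ => Finset.sum_comm, Finset.sum_comm]
      _ ≤ G * ∑ p : Fin N, G * ∑ q : Fin M, ‖hVal t ((p + q + 1 : ℕ) : ℤ)‖ ^ 2 := by
          refine mul_le_mul_of_nonneg_left (Finset.sum_le_sum fun p _ => ?_) hG0
          refine mul_le_mul_of_nonneg_right ?_ (Finset.sum_nonneg fun _ _ => by positivity)
          rw [← hGn]
          refine sum_norm_hVal_comp_le htn (fun n : Fin N => (n : ℤ) - p) fun a b hab => ?_
          simp only at hab
          exact Fin.ext (by lia)
      _ = G ^ 2 * ∑ p : Fin N, ∑ q : Fin M, ‖hVal t ((p + q + 1 : ℕ) : ℤ)‖ ^ 2 := by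
          rw [← Finset.mul_sum]
          ring
      _ ≤ _ := by
          refine mul_le_mul_of_nonneg_left ?_ (by positivity)
          refine le_trans ?_ hK2
          exact sum_hankel_le (a := fun n : ℕ => ‖hVal t n‖ ^ 2) (fun _ => by positivity) hK1 N M
  have hsplit : ∀ n : Fin N, ∑ c : Fin (N + M), ‖B n c‖ ^ 2 =
      1 + ∑ q : Fin M,
        ‖∑ p : Fin N, hVal (-t) ((n : ℤ) - p) * hVal t ((p + q + 1 : ℕ) : ℤ)‖ ^ 2 := by
    intro n
    rw [← (finCongr (add_comm M N)).sum_comp, Fin.sum_univ_add, add_comm]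
    congr 1
    · rw [Finset.sum_eq_single n]
      · have : B n (finCongr (add_comm M N) (Fin.natAdd M n)) = 1 := by
          rw [hBapp]
          simpa using sum_hVal_neg_mul_hVal_fin t n n
        rw [this]
        simp
      · intro m _ hm
        have : B n (finCongr (add_comm M N) (Fin.natAdd M m)) = 0 := by
          rw [hBapp]
          have h := sum_hVal_neg_mul_hVal_fin t n m
          rw [if_neg (fun h => hm (Fin.ext h.symm))] at h
          simpa using h
        rw [this]
        simp
      · simp
    · rw [← Equiv.sum_comp (Fin.revPerm (n := M))]
      refine Finset.sum_congr rfl fun q _ => ?_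
      rw [hBapp]
      congr 2
      refine Finset.sum_congr rfl fun p _ => ?_
      congr 2
      have := q.2
      simp [Fin.val_rev]
      lia
  simp only [Matrix.transpose_apply]
  simp_rw [hsplit]
  rw [Finset.sum_add_distrib]
  simp only [Finset.sum_const, Finset.card_univ, Fintype.card_fin, nsmul_eq_mul, mul_one]
  linarith

/-! ### Pairings of square summable families -/

theorem summable_mul_of_sq {ι : Type*} {x y : ι → ℂ} (hx : Summable fun i => ‖x i‖ ^ 2)
    (hy : Summable fun i => ‖y i‖ ^ 2) : Summable fun i => x i * y i := by
  refine Summable.of_norm_bounded (hx.add hy) fun i => ?_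
  rw [norm_mul]
  nlinarith [sq_nonneg (‖x i‖ - ‖y i‖), sq_nonneg (‖x i‖ + ‖y i‖)]

/-- The Cauchy–Schwarz bound on the tail of a pairing of square summable families. -/
theorem norm_tsum_mul_sub_sum_le {ι : Type*} {x y : ι → ℂ} (hx : Summable fun i => ‖x i‖ ^ 2)
    (hy : Summable fun i => ‖y i‖ ^ 2) (F : Finset ι) :
    ‖∑' i, x i * y i - ∑ i ∈ F, x i * y i‖ ≤
      √(∑' i, ‖x i‖ ^ 2 - ∑ i ∈ F, ‖x i‖ ^ 2) * √(∑' i, ‖y i‖ ^ 2) := by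
  classical
  have hlim : Tendsto (fun s : Finset ι => ‖∑ i ∈ s, x i * y i - ∑ i ∈ F, x i * y i‖) atTop
      (𝓝 ‖∑' i, x i * y i - ∑ i ∈ F, x i * y i‖) :=
    ((summable_mul_of_sq hx hy).hasSum.sub_const _).norm
  refine le_of_tendsto hlim ?_
  filter_upwards [eventually_ge_atTop F] with s hs
  rw [← Finset.sum_sdiff hs, add_sub_cancel_right]
  calc ‖∑ i ∈ s \ F, x i * y i‖ ≤ ∑ i ∈ s \ F, ‖x i‖ * ‖y i‖ := by
        refine (norm_sum_le _ _).trans (le_of_eq ?_)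
        simp only [norm_mul]
    _ ≤ √(∑ i ∈ s \ F, ‖x i‖ ^ 2) * √(∑ i ∈ s \ F, ‖y i‖ ^ 2) :=
        Real.sum_mul_le_sqrt_mul_sqrt _ _ _
    _ ≤ _ := by
        gcongr
        · rw [le_sub_iff_add_le, Finset.sum_sdiff hs]
          exact hx.sum_le_tsum _ fun _ _ => by positivity
        · exact hy.sum_le_tsum _ fun _ _ => by positivity

/-- Bounded pointwise convergent sequences converge weakly in `ℓ²`. -/
theorem tendsto_tsum_mul_of_bounded_sq {ι : Type*} {a : ℕ → ι → ℂ} {p b : ι → ℂ} {C : ℝ}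
    (ha : ∀ N (F : Finset ι), ∑ i ∈ F, ‖a N i‖ ^ 2 ≤ C) (hb : Summable fun i => ‖b i‖ ^ 2)
    (hlim : ∀ i, Tendsto (fun N => a N i) atTop (𝓝 (p i))) :
    (Summable fun i => ‖p i‖ ^ 2) ∧
      Tendsto (fun N => ∑' i, a N i * b i) atTop (𝓝 (∑' i, p i * b i)) := by
  have hpC : ∀ F : Finset ι, ∑ i ∈ F, ‖p i‖ ^ 2 ≤ C := fun F =>
    le_of_tendsto' (tendsto_finsetSum F fun i _ => (hlim i).norm.pow 2) fun N => ha N F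
  have hps := summable_of_sum_le (fun _ => by positivity) hpC
  have has : ∀ N, Summable fun i => ‖a N i‖ ^ 2 := fun N =>
    summable_of_sum_le (fun _ => by positivity) (ha N)
  refine ⟨hps, ?_⟩
  have hunif : TendstoUniformlyOnFilter (fun (F : Finset ι) (N : ℕ) => ∑ i ∈ F, a N i * b i)
      (fun N => ∑' i, a N i * b i) atTop atTop := by
    refine TendstoUniformly.tendstoUniformlyOnFilter ?_ |>.mono_right le_top
    rw [Metric.tendstoUniformly_iff]
    intro ε hε
    have h0 : Tendsto (fun F : Finset ι => √(∑' i, ‖b i‖ ^ 2 - ∑ i ∈ F, ‖b i‖ ^ 2) * √C)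
        atTop (𝓝 0) := by
      have h1 : Tendsto (fun F : Finset ι => ∑' i, ‖b i‖ ^ 2 - ∑ i ∈ F, ‖b i‖ ^ 2) atTop
          (𝓝 0) := by
        have := hb.hasSum.const_sub (∑' i, ‖b i‖ ^ 2)
        rwa [sub_self] at this
      simpa using (h1.sqrt).mul_const (√C)
    filter_upwards [h0.eventually_lt_const hε] with F hF N
    rw [dist_eq_norm]
    refine lt_of_le_of_lt ?_ hF
    have := norm_tsum_mul_sub_sum_le hb (has N) F
    simp_rw [mul_comm (b _)] at this
    refine this.trans ?_
    gcongr
    exact (has N).tsum_le_of_sum_le (ha N)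
  refine hunif.tendsto_of_eventually_tendsto (L := fun F => ∑ i ∈ F, p i * b i) ?_ ?_
  · exact Eventually.of_forall fun F => tendsto_finsetSum F fun i _ => (hlim i).mul_const _
  · exact (summable_mul_of_sq hps hb).hasSum

/-! ### The Schur expansion for frames close to the standard one -/

/-- A matrix with rows indexed by exponents `n ∈ ℤ` and columns by `j ∈ ℕ` that differs from the
matrix `δ_{nj}` of the standard frame `1, z, z², …` by a Hilbert–Schmidt matrix with absolutely
summable diagonal. -/
structure IsNearStandard (V : ℤ → ℕ → ℂ) : Prop where
  sq : Summable fun p : ℤ × ℕ => ‖V p.1 p.2 - if p.1 = (p.2 : ℤ) then 1 else 0‖ ^ 2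
  diag : Summable fun j : ℕ => ‖V j j - 1‖

/-- A bound for `∑_λ |π_λ|²`. -/
def frameBound (V : ℤ → ℕ → ℂ) : ℝ :=
  Real.exp (2 * ∑' j : ℕ, ‖V j j - 1‖ +
    ∑' p : ℤ × ℕ, ‖V p.1 p.2 - if p.1 = (p.2 : ℤ) then 1 else 0‖ ^ 2)

variable {V : ℤ → ℕ → ℂ}

theorem IsNearStandard.sum_box_norm_frameMinor_sq_le (hV : IsNearStandard V) (N M : ℕ) :
    ∑ μ ∈ box N M, ‖frameMinor V N μ‖ ^ 2 ≤ frameBound V := by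
  have h := sum_norm_det_submatrix_sq_le (frameBlock V N M)
  simp_rw [det_frameBlock_submatrix] at h
  rw [sum_box]
  refine h.trans (Real.exp_le_exp.2 ?_)
  set K : ℤ × ℕ → ℂ := fun p => V p.1 p.2 - if p.1 = (p.2 : ℤ) then 1 else 0 with hK
  have h1 : ∑ j, ∑ i, ‖frameBlock V N M i j‖ ^ 2 ≤
      ∑ j : Fin N, ∑ c : Fin (N + M), ((if (c : ℤ) - M = (j : ℤ)
        then 1 + 2 * ‖K ((c : ℤ) - M, j)‖ else 0) + ‖K ((c : ℤ) - M, j)‖ ^ 2) := by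
    refine Finset.sum_le_sum fun j _ => Finset.sum_le_sum fun c _ => ?_
    have : frameBlock V N M c j =
        (if (c : ℤ) - M = ((j : ℕ) : ℤ) then 1 else 0) + K ((c : ℤ) - M, j) := by
      simp [hK, frameBlock]
    rw [this]
    exact norm_ite_add_sq_le _
  have h2 : ∀ j : Fin N, ∑ c : Fin (N + M), (if (c : ℤ) - M = (j : ℤ)
      then 1 + 2 * ‖K ((c : ℤ) - M, j)‖ else 0) = 1 + 2 * ‖V (j : ℕ) j - 1‖ := by
    intro j
    rw [Finset.sum_eq_single ⟨j + M, by have := j.2; lia⟩]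
    · simp [hK]
    · intro c _ hc
      rw [if_neg]
      intro h
      exact hc (Fin.ext (by simp only; lia))
    · simp
  have h3 : ∑ j : Fin N, ‖V (j : ℕ) j - 1‖ ≤ ∑' j : ℕ, ‖V j j - 1‖ := by
    rw [Fin.sum_univ_eq_sum_range (fun j : ℕ => ‖V j j - 1‖) N]
    exact hV.diag.sum_le_tsum _ fun _ _ => norm_nonneg _
  have h4 : ∑ j : Fin N, ∑ c : Fin (N + M), ‖K ((c : ℤ) - M, j)‖ ^ 2 ≤
      ∑' p : ℤ × ℕ, ‖K p‖ ^ 2 := by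
    rw [← Fintype.sum_prod_type' (fun (j : Fin N) (c : Fin (N + M)) => ‖K ((c : ℤ) - M, j)‖ ^ 2)]
    have hinj : Function.Injective
        (fun x : Fin N × Fin (N + M) => (((x.2 : ℤ) - M, (x.1 : ℕ)) : ℤ × ℕ)) := by
      rintro ⟨j, c⟩ ⟨j', c'⟩ hx
      simp only [Prod.mk.injEq] at hx
      ext <;> simp only <;> lia
    refine le_trans (le_of_eq (Finset.sum_map Finset.univ ⟨_, hinj⟩ (fun p => ‖K p‖ ^ 2)).symm) ?_
    exact hV.sq.sum_le_tsum _ fun _ _ => by positivity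
  simp_rw [Finset.sum_add_distrib, h2] at h1
  rw [Finset.sum_add_distrib, ← Finset.mul_sum] at h1
  simp only [Finset.sum_const, Finset.card_univ, Fintype.card_fin, nsmul_eq_mul, mul_one] at h1
  linarith

theorem IsNearStandard.summable_sq_comp (hV : IsNearStandard V) {φ : ℕ → ℤ}
    (hφ : Function.Injective φ) : Summable fun p : ℕ × ℕ =>
      ‖V (φ p.1) p.2 - if φ p.1 = (p.2 : ℤ) then 1 else 0‖ ^ 2 :=
  (hV.sq.comp_injective (hφ.prodMap (Function.injective_id (α := ℕ)))).congr fun _ => rfl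

/-- The rows `z^{k - λ_k}` have a determinant: they differ from the rows `zᵏ` in finitely many
places, so the matrix is still the identity plus a Hilbert–Schmidt matrix with summable
diagonal. -/
theorem IsNearStandard.exists_hasInfDet (hV : IsNearStandard V) (μ : YoungDiagram) :
    ∃ d, HasInfDet (Matrix.of fun k j : ℕ => V ((k : ℤ) - μ.rowLen k) j) d := by
  set A : Matrix ℕ ℕ ℂ := Matrix.of fun k j : ℕ => V ((k : ℤ) - μ.rowLen k) j with hA
  refine KP.exists_hasInfDet (K := A - 1) (by simp) ?_ ?_
  · set x : ℕ × ℕ → ℂ := fun p => V ((p.1 : ℤ) - μ.rowLen p.1) p.2 -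
      if (p.1 : ℤ) - μ.rowLen p.1 = (p.2 : ℤ) then 1 else 0 with hx
    set y : ℕ × ℕ → ℂ := fun p => (if (p.1 : ℤ) - μ.rowLen p.1 = (p.2 : ℤ) then 1 else 0) -
      if p.1 = p.2 then 1 else 0 with hy
    have hinj : Function.Injective fun k : ℕ => (k : ℤ) - μ.rowLen k := by
      intro k k' h
      simp only at h
      rcases le_total k k' with hk | hk
      · have := μ.rowLen_anti _ _ hk
        lia
      · have := μ.rowLen_anti _ _ hk
        lia
    have hxs : Summable fun p => ‖x p‖ ^ 2 := (hV.summable_sq_comp hinj).congr fun _ => rfl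
    have hys : Summable fun p => ‖y p‖ ^ 2 := by
      refine summable_of_ne_finset_zero
        (s := Finset.range (μ.colLen 0) ×ˢ Finset.range (μ.colLen 0)) ?_
      rintro ⟨k, j⟩ hp
      have : y (k, j) = 0 := by
        simp only [Finset.mem_product, Finset.mem_range, not_and_or, not_lt,
          ← rowLen_eq_zero_iff (μ := μ)] at hp
        simp only [hy]
        rcases le_or_gt (μ.colLen 0) k with hk | hk
        · simp [rowLen_eq_zero_iff.2 hk]
        · have hj : μ.colLen 0 ≤ j := by
            rcases hp with h | h
            · exact absurd (rowLen_eq_zero_iff.1 h) (by lia)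
            · exact rowLen_eq_zero_iff.1 h
          rw [if_neg (by lia), if_neg (by lia), sub_self]
      simp [this]
    refine Summable.of_nonneg_of_le (fun _ => by positivity) (fun p => ?_)
      ((hxs.add hys).mul_left 2)
    have : (A - 1) p.1 p.2 = x p + y p := by
      simp [hA, hx, hy, Matrix.one_apply]
    rw [this]
    have := norm_add_le (x p) (y p)
    nlinarith [sq_nonneg (‖x p‖ - ‖y p‖), norm_nonneg (x p + y p)]
  · refine hV.diag.congr_cofinite ?_
    have : ∀ᶠ k in (cofinite : Filter ℕ), k ∉ Finset.range (μ.colLen 0) :=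
      (Finset.range _).finite_toSet.compl_mem_cofinite
    filter_upwards [this] with k hk
    have : μ.rowLen k = 0 := rowLen_eq_zero_iff.2 (by simpa using hk)
    simp [hA, this]

theorem summable_norm_schur_sq {t : ℕ+ → ℂ} (ht : IsFlowParam t) :
    (Summable fun μ => ‖MvPolynomial.eval t (schur μ)‖ ^ 2) ∧
      ∑' μ, ‖MvPolynomial.eval t (schur μ)‖ ^ 2 ≤ schurBound t := by
  have h : ∀ F : Finset YoungDiagram,
      ∑ μ ∈ F, ‖MvPolynomial.eval t (schur μ)‖ ^ 2 ≤ schurBound t := by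
    intro F
    obtain ⟨K, hK⟩ := exists_subset_box F
    exact (Finset.sum_le_sum_of_subset_of_nonneg (hK K K le_rfl le_rfl)
      fun _ _ _ => by positivity).trans (sum_box_norm_schur_sq_le ht K K)
  have hs := summable_of_sum_le (fun _ => by positivity) h
  exact ⟨hs, hs.tsum_le_of_sum_le h⟩

/-- As `M → ∞` the product of the blocks tends to the matrix of the flowed frame. -/
theorem tendsto_flowBlock_mul_frameBlock {t : ℕ+ → ℂ} {U : ℕ → ℕ → ℂ}
    (hU : ∀ n j : ℕ, HasSum (fun k : ℕ => hVal t k * V ((n : ℤ) - k) j) (U n j)) {N : ℕ}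
    (n j : Fin N) :
    Tendsto (fun M => (flowBlock t N M * frameBlock V N M) n j) atTop (𝓝 (U n j)) := by
  have hn := n.2
  have h := (hU n j).tendsto_sum_nat.comp (tendsto_add_atTop_nat (n + 1))
  refine h.congr fun M => ?_
  simp only [Function.comp, Matrix.mul_apply, flowBlock, frameBlock, Matrix.of_apply]
  rw [Fin.sum_univ_eq_sum_range
    (fun c => hVal t ((n : ℤ) - ((c : ℤ) - M)) * V ((c : ℤ) - M) j) (N + M),
    ← Finset.sum_subset (Finset.range_subset_range.2 (by lia : M + (n + 1) ≤ N + M)),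
    ← Finset.sum_range_reflect]
  · refine Finset.sum_congr rfl fun k hk => ?_
    have := Finset.mem_range.1 hk
    congr 2 <;> lia
  · intro c _ hc
    have : M + (n + 1) ≤ c := by simpa using hc
    rw [hVal_of_neg t (by lia), zero_mul]

/-- **Schur expansion.** The Cauchy–Binet formula expands the `N`-th minor of the flow applied to
`V` along the diagrams with at most `N` rows. Both factors of the expansion are square summable
uniformly in `N`, so the limit `N → ∞` is a case of weak convergence in `ℓ²`. -/
theorem IsNearStandard.schur_expansion (hV : IsNearStandard V) {p : YoungDiagram → ℂ}
    (hp : ∀ μ, Tendsto (fun N => frameMinor V N μ) atTop (𝓝 (p μ))) {t : ℕ+ → ℂ}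
    (ht : IsFlowParam t) {U : ℕ → ℕ → ℂ}
    (hU : ∀ n j : ℕ, HasSum (fun k : ℕ => hVal t k * V ((n : ℤ) - k) j) (U n j)) :
    (Summable fun μ => ‖p μ‖ ^ 2) ∧
    HasInfDet (Matrix.of U) (∑' μ, p μ * MvPolynomial.eval t (schur μ)) := by
  classical
  set b : YoungDiagram → ℂ := fun μ => MvPolynomial.eval t (schur μ) with hb
  obtain ⟨hbs, -⟩ := summable_norm_schur_sq ht
  -- minors of size `N` matter only for diagrams with at most `N` rows
  set a : ℕ → YoungDiagram → ℂ := fun N μ => if μ.colLen 0 ≤ N then frameMinor V N μ else 0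
    with ha
  have hbox : ∀ N M, ∀ μ ∈ box N M, a N μ = frameMinor V N μ := fun N M μ hμ =>
    if_pos (mem_box.1 hμ).1
  have hfil : ∀ (N : ℕ) (F : Finset YoungDiagram), ∀ᶠ M in atTop,
      ∀ μ ∈ F, μ.colLen 0 ≤ N → μ ∈ box N M := by
    intro N F
    obtain ⟨K, hK⟩ := exists_subset_box F
    filter_upwards [eventually_ge_atTop K] with M hM μ hμ hN
    exact mem_box.2 ⟨hN, (mem_box.1 (hK (max K N) M (le_max_left _ _) hM hμ)).2⟩
  have haC : ∀ N (F : Finset YoungDiagram), ∑ μ ∈ F, ‖a N μ‖ ^ 2 ≤ frameBound V := by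
    intro N F
    obtain ⟨M, hM⟩ := (hfil N F).exists
    refine le_trans ?_ (hV.sum_box_norm_frameMinor_sq_le N M)
    rw [← Finset.sum_congr (s₁ := box N M) rfl (f := fun μ => ‖a N μ‖ ^ 2)
      fun μ hμ => by rw [hbox N M μ hμ],
      ← Finset.sum_filter_add_sum_filter_not F (fun μ => μ.colLen 0 ≤ N)]
    have h0 : ∑ μ ∈ F.filter (fun μ => ¬ μ.colLen 0 ≤ N), ‖a N μ‖ ^ 2 = 0 := by
      refine Finset.sum_eq_zero fun μ hμ => ?_
      simp [ha, (Finset.mem_filter.1 hμ).2]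
    rw [h0, add_zero]
    refine Finset.sum_le_sum_of_subset_of_nonneg (fun μ hμ => ?_) fun _ _ _ => by positivity
    exact hM μ (Finset.mem_filter.1 hμ).1 (Finset.mem_filter.1 hμ).2
  have halim : ∀ μ, Tendsto (fun N => a N μ) atTop (𝓝 (p μ)) := by
    intro μ
    refine (hp μ).congr' ?_
    filter_upwards [eventually_ge_atTop (μ.colLen 0)] with N hN
    exact (if_pos hN).symm
  obtain ⟨hps, hlim⟩ := tendsto_tsum_mul_of_bounded_sq haC hbs halim
  refine ⟨hps, hlim.congr fun N => ?_⟩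
  have has : Summable fun μ => ‖a N μ‖ ^ 2 := summable_of_sum_le (fun _ => by positivity) (haC N)
  -- both sides are the limit, as `M → ∞`, of the sums over the `N × M` rectangles
  have h1 : Tendsto (fun M => ∑ μ ∈ box N M, a N μ * b μ) atTop (𝓝 (∑' μ, a N μ * b μ)) := by
    have hS := (summable_mul_of_sq has hbs).hasSum
    rw [HasSum, SummationFilter.unconditional_filter] at hS
    refine Metric.tendsto_atTop.2 fun ε hε => ?_
    have hS' := Metric.tendsto_nhds.1 hS ε hε
    obtain ⟨F, hF⟩ := eventually_atTop.1 hS'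
    obtain ⟨M0, hM0⟩ := eventually_atTop.1 (hfil N F)
    refine ⟨M0, fun M hM => ?_⟩
    have hext : ∑ μ ∈ box N M, a N μ * b μ = ∑ μ ∈ F ∪ box N M, a N μ * b μ := by
      refine Finset.sum_subset Finset.subset_union_right fun μ hμ hμ' => ?_
      have hμF : μ ∈ F := (Finset.mem_union.1 hμ).resolve_right hμ'
      have : ¬ μ.colLen 0 ≤ N := fun h => hμ' (hM0 M hM μ hμF h)
      simp [ha, this]
    rw [hext]
    exact hF _ Finset.subset_union_left
  have h2 : Tendsto (fun M => (flowBlock t N M * frameBlock V N M).det) atTop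
      (𝓝 ((Matrix.of U).submatrix (Fin.val : Fin N → ℕ) (Fin.val : Fin N → ℕ)).det) := by
    have hmat : Tendsto (fun M => flowBlock t N M * frameBlock V N M) atTop
        (𝓝 ((Matrix.of U).submatrix (Fin.val : Fin N → ℕ) (Fin.val : Fin N → ℕ))) := by
      refine tendsto_pi_nhds.2 fun n => tendsto_pi_nhds.2 fun j => ?_
      exact tendsto_flowBlock_mul_frameBlock hU n j
    exact ((continuous_id.matrix_det).tendsto _).comp hmat
  refine tendsto_nhds_unique h1 (h2.congr fun M => ?_)
  rw [det_flowBlock_mul_frameBlock]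
  exact Finset.sum_congr rfl fun μ hμ => by rw [hbox N M μ hμ]

/-! ### Trace class and Hilbert–Schmidt operators in orthonormal families -/

section Operators

variable {E F G : Type*} [NormedAddCommGroup E] [InnerProductSpace ℂ E]
  [NormedAddCommGroup F] [InnerProductSpace ℂ F] [NormedAddCommGroup G] [InnerProductSpace ℂ G]

theorem Orthonormal.sum_norm_inner_mul_le {ι : Type*} {b : ι → E} (hb : Orthonormal ℂ b)
    (x y : E) (s : Finset ι) :
    ∑ j ∈ s, ‖inner ℂ (b j) x‖ * ‖inner ℂ (b j) y‖ ≤ ‖x‖ * ‖y‖ := by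
  refine (Real.sum_mul_le_sqrt_mul_sqrt _ _ _).trans ?_
  gcongr
  · exact Real.sqrt_le_iff.2 ⟨norm_nonneg _, hb.sum_inner_products_le x⟩
  · exact Real.sqrt_le_iff.2 ⟨norm_nonneg _, hb.sum_inner_products_le y⟩

/-- The diagonal of `S T`, for `T` of trace class and `S` bounded, is absolutely summable. -/
theorem IsTraceClass.summable_inner {T : E →L[ℂ] E} (hT : IsTraceClass T) (S : E →L[ℂ] E)
    {ι : Type*} {b : ι → E} (hb : Orthonormal ℂ b) :
    Summable fun j => ‖inner ℂ (b j) (S (T (b j)))‖ := by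
  obtain ⟨x, y, hs, hxy⟩ := hT
  have hle : ∀ (n : ℕ) (s : Finset ι),
      ∑ j ∈ s, ‖inner ℂ (b j) (y n)‖ * ‖inner ℂ (b j) (S (x n))‖ ≤
        ‖S‖ * (‖x n‖ * ‖y n‖) := by
    intro n s
    refine (Orthonormal.sum_norm_inner_mul_le hb _ _ _).trans ?_
    have := S.le_opNorm (x n)
    nlinarith [norm_nonneg (y n)]
  have hsum : ∀ j, Summable fun n => ‖inner ℂ (b j) (y n)‖ * ‖inner ℂ (b j) (S (x n))‖ := by
    intro j
    refine Summable.of_nonneg_of_le (fun _ => by positivity) (fun n => ?_) (hs.mul_left ‖S‖)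
    simpa using hle n {j}
  have hbd : ∀ j, ‖inner ℂ (b j) (S (T (b j)))‖ ≤
      ∑' n, ‖inner ℂ (b j) (y n)‖ * ‖inner ℂ (b j) (S (x n))‖ := by
    intro j
    have h1 := ((hxy (b j)).mapL S).mapL (innerSL ℂ (b j))
    simp only [map_smul, smul_eq_mul, innerSL_apply_apply] at h1
    rw [← h1.tsum_eq]
    have h2 : ∀ n, ‖inner ℂ (y n) (b j) * inner ℂ (b j) (S (x n))‖ =
        ‖inner ℂ (b j) (y n)‖ * ‖inner ℂ (b j) (S (x n))‖ := by
      intro n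
      rw [norm_mul, norm_inner_symm]
    simp_rw [← h2]
    refine norm_tsum_le_tsum_norm ?_
    simp_rw [h2]
    exact hsum j
  refine summable_of_sum_le (c := ∑' n, ‖S‖ * (‖x n‖ * ‖y n‖)) (fun _ => norm_nonneg _) fun s => ?_
  refine (Finset.sum_le_sum fun j _ => hbd j).trans ?_
  rw [← Summable.tsum_finsetSum fun j _ => hsum j]
  exact (summable_sum fun j _ => hsum j).tsum_le_tsum (fun n => hle n s) (hs.mul_left _)

/-- By Bessel's inequality. -/
theorem summable_inner_sq_of_orthonormal {ι κ : Type*} {b : ι → E} (hb : Orthonormal ℂ b)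
    {v : κ → E} (hv : Summable fun j => ‖v j‖ ^ 2) :
    Summable fun p : κ × ι => ‖inner ℂ (b p.2) (v p.1)‖ ^ 2 := by
  rw [summable_prod_of_nonneg fun _ => by positivity]
  refine ⟨fun j => hb.inner_products_summable (v j), ?_⟩
  exact Summable.of_nonneg_of_le (fun _ => tsum_nonneg fun _ => by positivity)
    (fun j => hb.tsum_inner_products_le (v j)) hv

/-- Trace class operators are Hilbert–Schmidt: `‖T b‖² = ⟨b, T* T b⟩`. -/
theorem IsTraceClass.summable_norm_sq [CompleteSpace E] {T : E →L[ℂ] E} (hT : IsTraceClass T)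
    {ι : Type*} {b : ι → E} (hb : Orthonormal ℂ b) : Summable fun j => ‖T (b j)‖ ^ 2 := by
  refine (hT.summable_inner (ContinuousLinearMap.adjoint T) hb).congr fun j => ?_
  rw [ContinuousLinearMap.adjoint_inner_right, inner_self_eq_norm_sq_to_K]
  simp

theorem tsum_norm_inner_sq {ι : Type*} (a : HilbertBasis ι ℂ E) (x : E) :
    ∑' i, ‖inner ℂ (a i) x‖ ^ 2 = ‖x‖ ^ 2 := by
  have h := a.tsum_inner_mul_inner x x
  have h5 : ∀ i, inner ℂ x (a i) * inner ℂ (a i) x = ((‖inner ℂ (a i) x‖ ^ 2 : ℝ) : ℂ) := by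
    intro i
    rw [← inner_conj_symm]
    push_cast
    exact Complex.conj_mul' _
  simp_rw [h5] at h
  rw [← Complex.ofReal_tsum, inner_self_eq_norm_sq_to_K] at h
  apply Complex.ofReal_injective
  rw [h]
  simp

/-- A Hilbert–Schmidt operator composed with a bounded one has square summable matrix entries
with respect to any orthonormal families. -/
theorem IsHilbertSchmidt.summable_inner_sq [CompleteSpace E] [CompleteSpace F] [CompleteSpace G]
    {Q : E →L[ℂ] F} (hQ : IsHilbertSchmidt Q) (R : G →L[ℂ] E) {ι κ : Type*} {c : κ → F}
    (hc : Orthonormal ℂ c) {b : ι → G} (hb : Orthonormal ℂ b) :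
    Summable fun p : κ × ι => ‖inner ℂ (c p.1) (Q (R (b p.2)))‖ ^ 2 := by
  obtain ⟨s, a, ha⟩ := hQ
  have h1 : Summable fun p : s × κ => ‖inner ℂ (c p.2) (Q (a p.1))‖ ^ 2 :=
    summable_inner_sq_of_orthonormal (v := fun i : s => Q (a i)) hc ha
  have h1' : Summable fun p : κ × s => ‖inner ℂ (c p.1) (Q (a p.2))‖ ^ 2 := h1.prod_symm
  have h2 : Summable fun k => ‖ContinuousLinearMap.adjoint Q (c k)‖ ^ 2 := by
    refine h1'.prod.congr fun k => ?_
    rw [← tsum_norm_inner_sq a]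
    refine tsum_congr fun i => ?_
    rw [ContinuousLinearMap.adjoint_inner_right, norm_inner_symm]
  have h3 : Summable fun k =>
      ‖ContinuousLinearMap.adjoint R (ContinuousLinearMap.adjoint Q (c k))‖ ^ 2 := by
    refine Summable.of_nonneg_of_le (fun _ => by positivity) (fun k => ?_)
      (h2.mul_left (‖ContinuousLinearMap.adjoint R‖ ^ 2))
    rw [← mul_pow]
    gcongr
    exact ContinuousLinearMap.le_opNorm _ _
  refine (summable_inner_sq_of_orthonormal hb h3).congr fun p => ?_
  rw [ContinuousLinearMap.adjoint_inner_right, ContinuousLinearMap.adjoint_inner_right,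
    norm_inner_symm]

end Operators

/-! ### Fourier coefficients of admissible frames -/

theorem inner_zpow (n : ℤ) (g : H) : inner ℂ (zpow n) g = fourierCoeff g n := by
  rw [← fourierBasis_repr, HilbertBasis.repr_apply_apply, coe_fourierBasis]
  rfl

theorem orthonormal_zpow : Orthonormal ℂ zpow := orthonormal_fourier

theorem zpow_mem_Hminus (n : ℕ) : zpow (-(n : ℤ) - 1) ∈ Hminus := by
  apply Submodule.le_topologicalClosure
  apply Submodule.subset_span
  exact ⟨n, by simp, rfl⟩

theorem inner_projPlus (n : ℕ) (g : H) :
    inner ℂ (⟨zpow n, zpow_mem_Hplus n⟩ : Hplus) (projPlus g) = fourierCoeff g n := by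
  rw [projPlus, Submodule.inner_orthogonalProjectionOnto_eq_of_mem_left, inner_zpow]

theorem inner_projMinus (n : ℕ) (g : H) :
    inner ℂ (⟨zpow (-(n : ℤ) - 1), zpow_mem_Hminus n⟩ : Hminus) (projMinus g) =
      fourierCoeff g (-(n : ℤ) - 1) := by
  rw [projMinus, Submodule.inner_orthogonalProjectionOnto_eq_of_mem_left, inner_zpow]

theorem orthonormal_zpow_Hplus :
    Orthonormal ℂ fun n : ℕ => (⟨zpow n, zpow_mem_Hplus n⟩ : Hplus) :=
  (orthonormal_zpow.comp _ Nat.cast_injective).codRestrict Hplus zpow_mem_Hplus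

theorem orthonormal_zpow_Hminus :
    Orthonormal ℂ fun n : ℕ => (⟨zpow (-(n : ℤ) - 1), zpow_mem_Hminus n⟩ : Hminus) :=
  (orthonormal_zpow.comp (fun n : ℕ => -(n : ℤ) - 1) (fun a b h => by
    simp only at h; lia)).codRestrict Hminus zpow_mem_Hminus

/-- The trace class condition on the `H₊`-component of the frame controls the rows `n ≥ 0`, the
Hilbert–Schmidt condition on `w → H₋` the rows `n < 0`. -/
theorem IsAdmissibleFrame.isNearStandard {w : Submodule ℂ H} (hw : w ∈ Gr) {f : ℕ → H}
    (hf : IsAdmissibleFrame w f) : IsNearStandard fun n j => fourierCoeff (f j) n := by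
  obtain ⟨hcl, -, -, hHS⟩ := hw
  obtain ⟨Φ, -, hrange, hΦ, hT⟩ := hf
  have : CompleteSpace w := hcl.completeSpace_coe
  set b : ℕ → Hplus := fun n => ⟨zpow n, zpow_mem_Hplus n⟩ with hb
  have hbo : Orthonormal ℂ b := orthonormal_zpow_Hplus
  set T := projPlus ∘L Φ - ContinuousLinearMap.id ℂ Hplus with hTdef
  have hentry : ∀ n j : ℕ, inner ℂ (b n) (T (b j)) =
      fourierCoeff (f j) n - if (n : ℤ) = (j : ℤ) then 1 else 0 := by
    intro n j
    have h1 : T (b j) = projPlus (f j) - b j := by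
      rw [← hΦ j]
      rfl
    rw [h1, inner_sub_right, inner_projPlus, orthonormal_iff_ite.1 hbo]
    simp only [Nat.cast_inj]
  have hdiag := hT.summable_inner (ContinuousLinearMap.id ℂ Hplus) hbo
  have hplus := summable_inner_sq_of_orthonormal hbo (hT.summable_norm_sq hbo)
  let R : Hplus →L[ℂ] w := Φ.codRestrict w fun x => by
    rw [← hrange]
    exact LinearMap.mem_range_self _ x
  have hminus := hHS.summable_inner_sq R orthonormal_zpow_Hminus hbo
  refine ⟨?_, ?_⟩
  · set g : ℤ × ℕ → ℝ := fun p =>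
      ‖fourierCoeff (f p.2) p.1 - if p.1 = (p.2 : ℤ) then 1 else 0‖ ^ 2 with hg
    set g₁ : ℤ × ℕ → ℝ := fun p => if 0 ≤ p.1 then g p else 0 with hg₁
    set g₂ : ℤ × ℕ → ℝ := fun p => if 0 ≤ p.1 then 0 else g p with hg₂
    have hsum : g = g₁ + g₂ := by
      ext p
      simp only [hg₁, hg₂, Pi.add_apply]
      split_ifs <;> simp
    have h1 : Summable g₁ := by
      have hi : Function.Injective (fun p : ℕ × ℕ => (((p.1 : ℕ) : ℤ), p.2)) := by
        rintro ⟨a, c⟩ ⟨a', c'⟩ h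
        simpa using h
      refine (hi.summable_iff ?_).1 ?_
      · rintro ⟨n, j⟩ hnj
        refine if_neg fun h => hnj ⟨(n.toNat, j), ?_⟩
        simp only at h
        simp [h]
      · refine hplus.prod_symm.congr fun p => ?_
        simp only [Prod.fst_swap, Prod.snd_swap, hentry, Function.comp, hg₁, hg]
        simp
    have h2 : Summable g₂ := by
      have hi : Function.Injective (fun p : ℕ × ℕ => (-((p.1 : ℕ) : ℤ) - 1, p.2)) := by
        rintro ⟨a, c⟩ ⟨a', c'⟩ h
        simpa using h
      refine (hi.summable_iff ?_).1 ?_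
      · rintro ⟨n, j⟩ hnj
        refine if_pos ?_
        by_contra! h
        simp only at h
        refine hnj ⟨((-n - 1).toNat, j), ?_⟩
        simp only [Prod.mk.injEq, and_true]
        lia
      · refine hminus.congr fun p => ?_
        have h3 : (projMinus ∘L w.subtypeL) (R (b p.2)) = projMinus (f p.2) := by
          rw [← hΦ p.2]
          rfl
        rw [h3, inner_projMinus]
        simp only [Function.comp, hg₂, hg]
        rw [if_neg (by lia), if_neg (by lia), sub_zero]
    rw [hsum]
    exact h1.add h2
  · refine hdiag.congr fun j => ?_
    rw [ContinuousLinearMap.id_apply, hentry]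
    simp

theorem fourier_natCast_eq_pow (k : ℕ) (x : AddCircle (1 : ℝ)) :
    fourier (k : ℤ) x = fourier 1 x ^ k := by
  induction k with
  | zero => simp
  | succ k ih => rw [Nat.cast_succ, fourier_add, ih, pow_succ]

theorem norm_fourier_apply (n : ℤ) (x : AddCircle (1 : ℝ)) : ‖fourier n x‖ = 1 := by
  rw [fourier_apply, Circle.norm_coe]

theorem hasSum_gamma {t : ℕ+ → ℂ} (ht : Summable fun i => ‖t i‖) (x : AddCircle (1 : ℝ)) :
    HasSum (fun k : ℕ => hVal t k * fourier (k : ℤ) x) (gamma t x) := by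
  have h := (hVal_summable_and_hasSum ht (norm_fourier_apply 1 x).le).2.2
  have h1 : ∀ i : ℕ+, (fourier 1 x : ℂ) ^ (i : ℕ) = fourier (i : ℤ) x := fun i =>
    (fourier_natCast_eq_pow i x).symm
  simp_rw [h1, ← fourier_natCast_eq_pow] at h
  exact h

/-- Multiplication by `γ(t)` convolves the Fourier coefficients with the `h_k(t)`. -/
theorem hasSum_fourierCoeff_gamma_mul {t : ℕ+ → ℂ} (ht : Summable fun i => ‖t i‖) (g : H)
    (n : ℤ) : HasSum (fun k : ℕ => hVal t k * fourierCoeff g (n - k))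
      (fourierCoeff (fun x => gamma t x * g x) n) := by
  have hg : Integrable g (@AddCircle.haarAddCircle (1 : ℝ) _) :=
    (Lp.memLp g).integrable one_le_two
  obtain ⟨hs, -⟩ := hVal_summable_and_hasSum ht (z := 0) (by simp)
  have hint : ∀ k : ℕ, Integrable (fun x => hVal t k * (fourier (-(n - k)) x • g x))
      (@AddCircle.haarAddCircle (1 : ℝ) _) := fun k => (hg.fourier_smul _).const_mul _
  have h := hasSum_integral_of_summable_integral_norm hint (by
    have : ∀ k : ℕ, ∫ x, ‖hVal t k * (fourier (-(n - k)) x • g x)‖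
        ∂(@AddCircle.haarAddCircle (1 : ℝ) _) =
        ‖hVal t k‖ * ∫ x, ‖g x‖ ∂(@AddCircle.haarAddCircle (1 : ℝ) _) := by
      intro k
      rw [← integral_const_mul]
      refine integral_congr_ae (Eventually.of_forall fun x => ?_)
      simp only [norm_mul, norm_smul, norm_fourier_apply, one_mul]
    simp_rw [this]
    exact hs.mul_right _)
  have e1 : ∀ k : ℕ, ∫ x, hVal t k * (fourier (-(n - k)) x • g x)
      ∂(@AddCircle.haarAddCircle (1 : ℝ) _) = hVal t k * fourierCoeff g (n - k) := fun k =>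
    integral_const_mul _ _
  simp_rw [e1] at h
  refine (congrArg (HasSum _) ?_).mpr h
  unfold fourierCoeff
  refine integral_congr_ae (Eventually.of_forall fun x => ?_)
  have h2 := ((hasSum_gamma ht x).mul_right (fourier (-n) x * g x)).tsum_eq
  simp only [smul_eq_mul]
  rw [mul_left_comm, ← h2]
  refine tsum_congr fun k => ?_
  have : -(n - (k : ℤ)) = (k : ℤ) + -n := by ring
  rw [this, fourier_add]
  ring

/-! ### Limits of holomorphic functions of several variables -/

section Holomorphic

variable {E G : Type*} [NormedAddCommGroup E] [NormedSpace ℂ E] [NormedAddCommGroup G]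
  [NormedSpace ℂ G]

/-- Cauchy's estimate on the unit disc of each complex line through `x`. -/
theorem norm_fderiv_le_of_forall_closedBall {D : E → G} (hD : Differentiable ℂ D) {R ε : ℝ}
    (hε : 0 ≤ ε) (h : ∀ x ∈ Metric.closedBall (0 : E) (R + 1), ‖D x‖ ≤ ε) {x : E}
    (hx : x ∈ Metric.closedBall (0 : E) R) : ‖fderiv ℂ D x‖ ≤ ε := by
  refine ContinuousLinearMap.opNorm_le_bound _ hε fun v => ?_
  rcases eq_or_ne v 0 with rfl | hv
  · simp
  have hv' : 0 < ‖v‖ := norm_pos_iff.2 hv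
  have hline : ∀ z : ℂ, HasDerivAt (fun z : ℂ => x + z • v) v z := fun z => by
    simpa using ((hasDerivAt_id z).smul_const v).const_add x
  have hdiff : Differentiable ℂ fun z : ℂ => D (x + z • v) :=
    hD.comp fun z => (hline z).differentiableAt
  have hder : HasDerivAt (fun z : ℂ => D (x + z • v)) (fderiv ℂ D x v) 0 := by
    have h1 : HasFDerivAt D (fderiv ℂ D x) (x + (0 : ℂ) • v) := by
      simpa using (hD x).hasFDerivAt
    exact h1.comp_hasDerivAt 0 (hline 0)
  have hb := Complex.norm_deriv_le_of_forall_mem_sphere_norm_le (c := 0) (R := 1 / ‖v‖) (C := ε)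
    (f := fun z : ℂ => D (x + z • v)) (by positivity) hdiff.diffContOnCl (fun z hz => ?_)
  · rw [hder.deriv] at hb
    simpa using hb
  · refine h _ ?_
    have hz' : ‖z‖ = 1 / ‖v‖ := by simpa using hz
    have hx' : ‖x‖ ≤ R := by simpa using hx
    rw [mem_closedBall_zero_iff]
    refine (norm_add_le _ _).trans ?_
    rw [norm_smul, hz', one_div, inv_mul_cancel₀ hv'.ne']
    linarith

/-- A limit of holomorphic functions, uniform on balls, is holomorphic, and the derivatives
converge uniformly on balls. -/
theorem differentiable_of_tendstoUniformlyOn [CompleteSpace G] {ι : Type*} {l : Filter ι} [l.NeBot]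
    {F : ι → E → G} {f : E → G} (hF : ∀ n, Differentiable ℂ (F n))
    (h : ∀ R, TendstoUniformlyOn F f l (Metric.closedBall 0 R)) :
    Differentiable ℂ f ∧
      ∀ R, TendstoUniformlyOn (fun n => fderiv ℂ (F n)) (fderiv ℂ f) l
        (Metric.closedBall 0 R) := by
  have hC : ∀ R, UniformCauchySeqOn (fun n => fderiv ℂ (F n)) l (Metric.closedBall 0 R) := by
    intro R u hu
    obtain ⟨ε, hε, hεu⟩ := Metric.mem_uniformity_dist.1 hu
    have h1 := (h (R + 1)).uniformCauchySeqOn _ (Metric.dist_mem_uniformity (half_pos hε))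
    filter_upwards [h1] with m hm x hx
    apply hεu
    rw [dist_eq_norm, ← fderiv_sub (hF _ x) (hF _ x)]
    refine lt_of_le_of_lt (norm_fderiv_le_of_forall_closedBall ((hF _).sub (hF _))
      (half_pos hε).le (fun y hy => ?_) hx) (half_lt_self hε)
    have := hm y hy
    simp only [dist_eq_norm] at this
    exact this.le
  have hlim : ∀ x, ∃ T : E →L[ℂ] G, Tendsto (fun n => fderiv ℂ (F n) x) l (𝓝 T) := by
    intro x
    have hx : x ∈ Metric.closedBall (0 : E) ‖x‖ := by simp
    exact cauchy_map_iff_exists_tendsto.1 ((hC ‖x‖).cauchy_map hx)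
  choose g hg using hlim
  have hU : ∀ R, TendstoUniformlyOn (fun n => fderiv ℂ (F n)) g l (Metric.closedBall 0 R) :=
    fun R => (hC R).tendstoUniformlyOn_of_tendsto fun x _ => hg x
  have hd : ∀ x, HasFDerivAt f (g x) x := by
    intro x
    refine hasFDerivAt_of_tendstoUniformlyOn (s := Metric.ball 0 (‖x‖ + 1)) Metric.isOpen_ball
      ((hU (‖x‖ + 1)).mono Metric.ball_subset_closedBall)
      (fun n y _ => (hF n y).hasFDerivAt) (fun y _ => ?_) (by simp)
    exact (h ‖y‖).tendsto_at (by simp)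
  refine ⟨fun x => (hd x).differentiableAt, fun R => ?_⟩
  have : fderiv ℂ f = g := funext fun x => (hd x).fderiv
  rw [this]
  exact hU R

/-- A limit of smooth functions over `ℂ`, uniform on balls, is smooth. -/
theorem contDiff_of_tendstoUniformlyOn {ι : Type*} {l : Filter ι} [l.NeBot] {E : Type}
    [NormedAddCommGroup E] [NormedSpace ℂ E] {F : ι → E → ℂ} {f : E → ℂ}
    (hF : ∀ n, ContDiff ℂ (⊤ : ℕ∞) (F n))
    (h : ∀ R, TendstoUniformlyOn F f l (Metric.closedBall 0 R)) :
    ContDiff ℂ (⊤ : ℕ∞) f := by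
  -- the induction on the order of differentiability replaces `F n` by its derivative
  have key : ∀ k : ℕ, ∀ (G : Type) [NormedAddCommGroup G] [NormedSpace ℂ G]
      [CompleteSpace G] (F : ι → E → G) (f : E → G), (∀ n, ContDiff ℂ (⊤ : ℕ∞) (F n)) →
      (∀ R, TendstoUniformlyOn F f l (Metric.closedBall 0 R)) → ContDiff ℂ k f := by
    intro k
    induction k with
    | zero =>
      intro G _ _ _ F f hF h
      exact contDiff_zero.2 (differentiable_of_tendstoUniformlyOn
        (fun n => (hF n).differentiable (by simp)) h).1.continuous
    | succ k ih =>
      intro G _ _ _ F f hF h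
      obtain ⟨h1, h2⟩ := differentiable_of_tendstoUniformlyOn
        (fun n => (hF n).differentiable (by simp)) h
      push_cast
      rw [contDiff_succ_iff_fderiv]
      refine ⟨h1, by simp, ih _ (fun n => fderiv ℂ (F n)) _ (fun n => ?_) h2⟩
      exact (hF n).fderiv_right (by simp)
  exact contDiff_infty.2 fun k => key k ℂ F f hF h

end Holomorphic

/-! ### Derivatives in the flow variables -/

theorem extendZero_add_smul_single {s : Finset ℕ+} {i : ℕ+} (hi : i ∈ s) (u : s → ℂ) (z : ℂ) :
    extendZero s u + z • Pi.single i 1 = extendZero s (u + z • Pi.single ⟨i, hi⟩ 1) := by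
  ext j
  by_cases hj : j ∈ s
  · by_cases hij : j = i
    · subst hij
      simp [extendZero, hj]
    · have : (⟨j, hj⟩ : s) ≠ ⟨i, hi⟩ := fun h => hij (congrArg Subtype.val h)
      simp [extendZero, hj, hij, this]
  · have hij : j ≠ i := fun h => hj (h ▸ hi)
    simp [extendZero, hj, hij]

theorem extendZero_zero (s : Finset ℕ+) : extendZero s 0 = 0 := by
  ext j
  simp [extendZero]

theorem dt_extendZero {s : Finset ℕ+} {i : ℕ+} (hi : i ∈ s) {F : (ℕ+ → ℂ) → ℂ}
    (hF : Differentiable ℂ fun u => F (extendZero s u)) (u : s → ℂ) :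
    dt i F (extendZero s u) =
      (1 / (i : ℂ)) * fderiv ℂ (fun u => F (extendZero s u)) u (Pi.single ⟨i, hi⟩ 1) := by
  rw [dt, ← (hF u).lineDeriv_eq_fderiv, lineDeriv, lineDeriv]
  simp_rw [extendZero_add_smul_single hi]

/-- Smooth functions of the variables `tᵢ`, `i ∈ s`, converging uniformly on balls may be
differentiated termwise any number of times. -/
theorem tendsto_foldr_dt {ι : Type*} {l : Filter ι} [l.NeBot] {s : Finset ℕ+}
    {F : ι → (ℕ+ → ℂ) → ℂ} {f : (ℕ+ → ℂ) → ℂ}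
    (hF : ∀ n, ContDiff ℂ (⊤ : ℕ∞) fun u => F n (extendZero s u))
    (h : ∀ R, TendstoUniformlyOn (fun n u => F n (extendZero s u)) (fun u => f (extendZero s u)) l
      (Metric.closedBall 0 R)) (L : List ℕ+) (hL : ∀ i ∈ L, i ∈ s) :
    (∀ n, ContDiff ℂ (⊤ : ℕ∞) fun u => L.foldr dt (F n) (extendZero s u)) ∧
    ∀ R, TendstoUniformlyOn (fun n u => L.foldr dt (F n) (extendZero s u))
      (fun u => L.foldr dt f (extendZero s u)) l (Metric.closedBall 0 R) := by
  induction L with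
  | nil => exact ⟨hF, h⟩
  | cons i L ih =>
    obtain ⟨h1, h2⟩ := ih fun j hj => hL j (List.mem_cons_of_mem _ hj)
    have hi : i ∈ s := hL i List.mem_cons_self
    have hd : ∀ n, Differentiable ℂ fun u => L.foldr dt (F n) (extendZero s u) :=
      fun n => (h1 n).differentiable (by simp)
    obtain ⟨h3, h4⟩ := differentiable_of_tendstoUniformlyOn hd h2
    simp only [List.foldr_cons]
    have e1 : ∀ n, (fun u => dt i (L.foldr dt (F n)) (extendZero s u)) = fun u => (1 / (i : ℂ)) *
        fderiv ℂ (fun u => L.foldr dt (F n) (extendZero s u)) u (Pi.single ⟨i, hi⟩ 1) :=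
      fun n => funext (dt_extendZero hi (hd n))
    have e2 : (fun u => dt i (L.foldr dt f) (extendZero s u)) = fun u => (1 / (i : ℂ)) *
        fderiv ℂ (fun u => L.foldr dt f (extendZero s u)) u (Pi.single ⟨i, hi⟩ 1) :=
      funext (dt_extendZero hi h3)
    constructor
    · intro n
      rw [e1]
      exact contDiff_const.mul (((h1 n).fderiv_right (by simp)).clm_apply contDiff_const)
    · intro R
      rw [e2, show (fun n u => dt i (L.foldr dt (F n)) (extendZero s u)) = _ from funext e1]
      have hu : UniformContinuous fun T : (s → ℂ) →L[ℂ] ℂ =>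
          (1 / (i : ℂ)) * T (Pi.single ⟨i, hi⟩ 1) :=
        ((1 / (i : ℂ)) • ContinuousLinearMap.apply ℂ ℂ
          (Pi.single ⟨i, hi⟩ 1 : s → ℂ)).uniformContinuous
      exact hu.comp_tendstoUniformlyOn (h4 R)

theorem contDiff_eval_extendZero (s : Finset ℕ+) (P : MvPolynomial ℕ+ ℂ) :
    ContDiff ℂ (⊤ : ℕ∞) fun u => MvPolynomial.eval (extendZero s u) P := by
  induction P using MvPolynomial.induction_on with
  | C a => simpa using contDiff_const
  | add p q hp hq => simpa using hp.add hq
  | mul_X p i hp =>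
    have : ContDiff ℂ (⊤ : ℕ∞) fun u => extendZero s u i := by
      by_cases hi : i ∈ s
      · simpa [extendZero, hi] using contDiff_apply ℂ ℂ (⟨i, hi⟩ : s)
      · simpa [extendZero, hi] using contDiff_const
    simpa using hp.mul this

theorem hasDerivAt_eval_add_smul_single (P : MvPolynomial ℕ+ ℂ) (t : ℕ+ → ℂ) (i : ℕ+) :
    HasDerivAt (fun z : ℂ => MvPolynomial.eval (t + z • Pi.single i 1) P)
      (MvPolynomial.eval t (MvPolynomial.pderiv i P)) 0 := by
  induction P using MvPolynomial.induction_on with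
  | C a => simpa using hasDerivAt_const _ _
  | add p q hp hq =>
    simp only [map_add]
    exact hp.add hq
  | mul_X p j hp =>
    have hj : HasDerivAt (fun z : ℂ => t j + z * (Pi.single i (1 : ℂ) : ℕ+ → ℂ) j)
        ((Pi.single i (1 : ℂ) : ℕ+ → ℂ) j) 0 := by
      simpa using ((hasDerivAt_id (0 : ℂ)).mul_const
        ((Pi.single i (1 : ℂ) : ℕ+ → ℂ) j)).const_add (t j)
    have := hp.mul hj
    simp only [map_mul, MvPolynomial.eval_X, Pi.add_apply, Pi.smul_apply, smul_eq_mul]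
    refine this.congr_deriv ?_
    rw [MvPolynomial.pderiv_mul, MvPolynomial.pderiv_X]
    by_cases h : j = i
    · subst h
      simp
    · simp [Pi.single_eq_of_ne h]

theorem dt_eval (i : ℕ+) (P : MvPolynomial ℕ+ ℂ) :
    dt i (fun t => MvPolynomial.eval t P) =
      fun t => MvPolynomial.eval t ((1 / (i : ℂ)) • MvPolynomial.pderiv i P) := by
  ext t
  rw [dt, lineDeriv, (hasDerivAt_eval_add_smul_single P t i).deriv, MvPolynomial.smul_eval]

/-! ### The pairing `P(∂_t) Q |_{t = 0}` -/

/-- The value `∏ᵢ αᵢ! / i^{αᵢ}` of `((1/i) ∂/∂tᵢ)^α` on the monomial `t^α`. -/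
def dtWeight (α : ℕ+ →₀ ℕ) : ℂ := α.prod fun i k => (k.factorial : ℂ) / (i : ℂ) ^ k

theorem dtWeight_zero : dtWeight 0 = 1 := by simp [dtWeight]

theorem dtWeight_add_single (β : ℕ+ →₀ ℕ) (i : ℕ+) :
    dtWeight (β + Finsupp.single i 1) = dtWeight β * (((β i : ℂ) + 1) / i) := by
  classical
  have h0 : ∀ j ∈ insert i β.support, (((0 : ℕ).factorial : ℂ) / (j : ℂ) ^ 0) = 1 := by simp
  have hs : (β + Finsupp.single i 1).support ⊆ insert i β.support := by
    intro j hj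
    by_contra h
    simp only [Finset.mem_insert, not_or, Finsupp.mem_support_iff, not_not] at h
    simp [h.2, Finsupp.single_eq_of_ne h.1] at hj
  rw [dtWeight, dtWeight, Finsupp.prod_of_support_subset _ hs _ h0,
    Finsupp.prod_of_support_subset _ (Finset.subset_insert i β.support) _ h0,
    ← Finset.mul_prod_erase _ _ (Finset.mem_insert_self i β.support),
    ← Finset.mul_prod_erase _ _ (Finset.mem_insert_self i β.support)]
  have h1 : ∏ j ∈ (insert i β.support).erase i,
      (((β + Finsupp.single i 1 : ℕ+ →₀ ℕ) j).factorial : ℂ) /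
        (j : ℂ) ^ ((β + Finsupp.single i 1 : ℕ+ →₀ ℕ) j) =
      ∏ j ∈ (insert i β.support).erase i, ((β j).factorial : ℂ) / (j : ℂ) ^ (β j) := by
    refine Finset.prod_congr rfl fun j hj => ?_
    have : j ≠ i := Finset.ne_of_mem_erase hj
    simp [Finsupp.single_eq_of_ne this]
  rw [h1]
  have hi : ((i : ℕ) : ℂ) ≠ 0 := by exact_mod_cast i.ne_zero
  simp only [Finsupp.add_apply, Finsupp.single_eq_same, Nat.factorial_succ]
  push_cast
  field_simp
  ring

/-- The bilinear form `⟨P, Q⟩ = P(∂_t) Q |_{t = 0}` on `ℂ[t₁, t₂, …]`, where `tᵢ` acts as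
`(1/i) ∂/∂tᵢ`. Monomials are orthogonal. -/
def hallForm : MvPolynomial ℕ+ ℂ →ₗ[ℂ] MvPolynomial ℕ+ ℂ →ₗ[ℂ] ℂ :=
  (MvPolynomial.basisMonomials ℕ+ ℂ).constr ℂ fun α => dtWeight α • MvPolynomial.lcoeff ℂ α

theorem hallForm_monomial (α : ℕ+ →₀ ℕ) (c : ℂ) (Q : MvPolynomial ℕ+ ℂ) :
    hallForm (MvPolynomial.monomial α c) Q = c * (dtWeight α * MvPolynomial.coeff α Q) := by
  have h1 : hallForm (MvPolynomial.monomial α 1) = dtWeight α • MvPolynomial.lcoeff ℂ α := by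
    have := (MvPolynomial.basisMonomials ℕ+ ℂ).constr_basis ℂ
      (fun α => dtWeight α • MvPolynomial.lcoeff ℂ α) α
    rwa [MvPolynomial.coe_basisMonomials] at this
  have h2 : MvPolynomial.monomial α c = c • MvPolynomial.monomial α (1 : ℂ) := by
    rw [MvPolynomial.smul_monomial, smul_eq_mul, mul_one]
  rw [h2, map_smul, h1]
  rfl

theorem hallForm_C (P : MvPolynomial ℕ+ ℂ) (c : ℂ) :
    hallForm P (MvPolynomial.C c) = c * MvPolynomial.constantCoeff P := by
  classical
  induction P using MvPolynomial.induction_on' with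
  | monomial α a =>
    rw [hallForm_monomial, MvPolynomial.coeff_C, MvPolynomial.constantCoeff_monomial]
    by_cases h : α = 0
    · subst h
      simp [dtWeight_zero, mul_comm]
    · simp [h, Ne.symm h]
  | add p q hp hq => rw [map_add, LinearMap.add_apply, hp, hq, map_add, mul_add]

/-- Multiplication by `tᵢ` is adjoint to `(1/i) ∂/∂tᵢ`. -/
theorem hallForm_X_mul (P Q : MvPolynomial ℕ+ ℂ) (i : ℕ+) :
    hallForm P (MvPolynomial.X i * Q) = (1 / (i : ℂ)) * hallForm (MvPolynomial.pderiv i P) Q := by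
  classical
  induction P using MvPolynomial.induction_on' with
  | monomial α a =>
    rw [MvPolynomial.pderiv_monomial, hallForm_monomial, hallForm_monomial,
      MvPolynomial.coeff_X_mul']
    by_cases h : α i = 0
    · simp [h]
    · obtain ⟨β, rfl⟩ : ∃ β, α = β + Finsupp.single i 1 := by
        refine ⟨α - Finsupp.single i 1, ?_⟩
        rw [Finsupp.sub_add_single_one_cancel h]
      rw [if_pos (Finsupp.mem_support_iff.2 h), add_tsub_cancel_right, dtWeight_add_single]
      simp only [Finsupp.add_apply, Finsupp.single_eq_same]
      push_cast
      ring
  | add p q hp hq =>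
    rw [map_add, LinearMap.add_apply, hp, hq, map_add, map_add, LinearMap.add_apply, mul_add]

theorem foldr_dt_eval (L : List ℕ+) (Q : MvPolynomial ℕ+ ℂ) :
    L.foldr dt (fun t => MvPolynomial.eval t Q) = fun t => MvPolynomial.eval t
      (L.foldr (fun (i : ℕ+) (R : MvPolynomial ℕ+ ℂ) =>
        (1 / (i : ℂ)) • MvPolynomial.pderiv i R) Q) := by
  induction L with
  | nil => rfl
  | cons i L ih => rw [List.foldr_cons, ih, dt_eval, List.foldr_cons]

/-- Differentiating by `(1/i) ∂/∂tᵢ` for `i` in `L` shifts the exponents of coefficients by the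
multiset `L`; the weights absorb the factors. -/
theorem dtWeight_mul_coeff_foldr (L : List ℕ+) (Q : MvPolynomial ℕ+ ℂ) (β : ℕ+ →₀ ℕ) :
    dtWeight β * MvPolynomial.coeff β
      (L.foldr (fun (i : ℕ+) (R : MvPolynomial ℕ+ ℂ) =>
        (1 / (i : ℂ)) • MvPolynomial.pderiv i R) Q) =
    dtWeight (β + Multiset.toFinsupp (L : Multiset ℕ+)) *
      MvPolynomial.coeff (β + Multiset.toFinsupp (L : Multiset ℕ+)) Q := by
  induction L generalizing β with
  | nil => simp
  | cons i L ih =>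
    have h1 : β + Multiset.toFinsupp ((i :: L : List ℕ+) : Multiset ℕ+) =
        β + Finsupp.single i 1 + Multiset.toFinsupp (L : Multiset ℕ+) := by
      rw [← Multiset.cons_coe, ← Multiset.singleton_add, map_add, Multiset.toFinsupp_singleton,
        add_assoc]
    rw [h1, ← ih, List.foldr_cons, MvPolynomial.coeff_smul, MvPolynomial.coeff_pderiv,
      dtWeight_add_single, smul_eq_mul]
    ring

theorem dtMonomial_eval (α : ℕ+ →₀ ℕ) (Q : MvPolynomial ℕ+ ℂ) :
    dtMonomial α (fun t => MvPolynomial.eval t Q) 0 = dtWeight α * MvPolynomial.coeff α Q := by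
  have h := dtWeight_mul_coeff_foldr ((Finsupp.toMultiset α).sort (· ≤ ·)) Q 0
  rw [Multiset.sort_eq, Finsupp.toMultiset_toFinsupp, zero_add, dtWeight_zero, one_mul] at h
  rw [dtMonomial, foldr_dt_eval, ← h]
  change MvPolynomial.eval 0 _ = _
  rw [MvPolynomial.eval_zero, MvPolynomial.constantCoeff_eq]

theorem polyDt_eval (P Q : MvPolynomial ℕ+ ℂ) :
    polyDt P (fun t => MvPolynomial.eval t Q) 0 = hallForm P Q := by
  conv_rhs => rw [← MvPolynomial.support_sum_monomial_coeff P]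
  rw [map_sum, LinearMap.sum_apply, polyDt]
  refine Finset.sum_congr rfl fun α _ => ?_
  rw [hallForm_monomial, dtMonomial_eval]

/-! ### Orthonormality of the Schur functions -/

section Alternants

variable {N : ℕ}

/-- The specialisation `tᵢ = (1/i) ∑_k x_kⁱ` to power sums of `N` variables. -/
def powerSumVal (N : ℕ) (i : ℕ+) : MvPolynomial (Fin N) ℂ :=
  MvPolynomial.C (1 / (i : ℂ)) * ∑ k, MvPolynomial.X k ^ (i : ℕ)

/-- The substitution `tᵢ ↦ (1/i) ∑_k x_kⁱ`. -/
def toPowerSums (N : ℕ) : MvPolynomial ℕ+ ℂ →ₐ[ℂ] MvPolynomial (Fin N) ℂ :=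
  MvPolynomial.aeval (powerSumVal N)

open Classical in
/-- The coefficient of `x^a` for an integral exponent vector `a`; it vanishes when some exponent
is negative. -/
def intCoeff (a : Fin N → ℤ) : MvPolynomial (Fin N) ℂ →ₗ[ℂ] ℂ :=
  if ∀ k, 0 ≤ a k then
    MvPolynomial.lcoeff ℂ (Finsupp.equivFunOnFinite.symm fun k => (a k).toNat) else 0

/-- Stated for integral exponents so that no case distinction is needed for `x^β ∤ x^a`. -/
theorem intCoeff_monomial_mul (a : Fin N → ℤ) (β : Fin N →₀ ℕ) (F : MvPolynomial (Fin N) ℂ) :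
    intCoeff a (MvPolynomial.monomial β 1 * F) = intCoeff (fun k => a k - β k) F := by
  classical
  unfold intCoeff
  by_cases h : ∀ k, 0 ≤ a k - β k
  · have h' : ∀ k, 0 ≤ a k := fun k => by have := h k; lia
    rw [if_pos h, if_pos h', MvPolynomial.lcoeff_apply, MvPolynomial.lcoeff_apply,
      MvPolynomial.coeff_monomial_mul', if_pos, one_mul]
    · congr 1
      ext k
      have := h k
      simp
    · intro k
      have := h k
      simp
      lia
  · rw [if_neg h]
    by_cases h' : ∀ k, 0 ≤ a k
    · rw [if_pos h', MvPolynomial.lcoeff_apply, MvPolynomial.coeff_monomial_mul', if_neg]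
      · simp
      · intro hle
        refine h fun k => ?_
        have h1 := hle k
        have h2 := h' k
        simp at h1
        lia
    · rw [if_neg h']
      simp

theorem intCoeff_C (a : Fin N → ℤ) (c : ℂ) :
    intCoeff a (MvPolynomial.C c) = if ∀ k, a k = 0 then c else 0 := by
  classical
  unfold intCoeff
  by_cases h : ∀ k, a k = 0
  · rw [if_pos h, if_pos fun k => (h k).ge, MvPolynomial.lcoeff_apply, MvPolynomial.coeff_C,
      if_pos]
    ext k
    simp [h k]
  · rw [if_neg h]
    by_cases h' : ∀ k, 0 ≤ a k
    · rw [if_pos h', MvPolynomial.lcoeff_apply, MvPolynomial.coeff_C, if_neg]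
      intro h0
      refine h fun k => ?_
      have h1 := DFunLike.congr_fun h0 k
      have h2 := h' k
      simp at h1
      lia
    · rw [if_neg h']
      simp

theorem Derivation.leibniz_finsetProd {R A : Type*} [CommRing R] [CommRing A] [Algebra R A]
    (D : Derivation R A A) {ι : Type*} [DecidableEq ι] (s : Finset ι) (f : ι → A) :
    D (∏ k ∈ s, f k) = ∑ k ∈ s, (∏ l ∈ s.erase k, f l) * D (f k) := by
  induction s using Finset.induction_on with
  | empty => simp
  | insert a s ha ih =>
    rw [Finset.prod_insert ha, D.leibniz, ih, Finset.sum_insert ha, Finset.erase_insert ha,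
      smul_eq_mul, smul_eq_mul, add_comm, Finset.mul_sum]
    congr 1
    refine Finset.sum_congr rfl fun k hk => ?_
    have hak : a ≠ k := fun h => ha (h ▸ hk)
    rw [Finset.erase_insert_of_ne hak, Finset.prod_insert fun h => ha (Finset.mem_of_mem_erase h)]
    ring

theorem constantCoeff_completeHInt (m : ℤ) :
    MvPolynomial.constantCoeff (completeHInt m) = if m = 0 then 1 else 0 := by
  rcases lt_trichotomy m 0 with h | h | h
  · simp [completeHInt_of_neg h, h.ne]
  · simp [h, completeHInt_zero]
  · rw [if_neg h.ne']
    have h1 := congrArg MvPolynomial.constantCoeff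
      (intCast_mul_completeHInt m.toNat m (by lia))
    rw [map_mul, map_sum, Finset.sum_eq_zero, map_intCast] at h1
    · exact (mul_eq_zero.1 h1).resolve_left (by exact_mod_cast h.ne')
    · intro a _
      simp

/-- The products `h_{a₁} ⋯ h_{a_N}` reproduce coefficients: `⟨h_a, Q⟩` is the coefficient of `x^a`
in the image of `Q` under `tᵢ ↦ (1/i) ∑_k x_kⁱ`. This is the expansion
`exp (∑ tᵢ p_i(x)) = ∑_a h_a(t) x^a`. -/
theorem hallForm_prod_completeHInt (a : Fin N → ℤ) (Q : MvPolynomial ℕ+ ℂ) :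
    hallForm (∏ k, completeHInt (a k)) Q = intCoeff a (toPowerSums N Q) := by
  classical
  induction Q using MvPolynomial.induction_on generalizing a with
  | C c =>
    rw [hallForm_C, map_prod]
    simp_rw [constantCoeff_completeHInt]
    rw [Finset.prod_ite_zero]
    have : toPowerSums N (MvPolynomial.C c) = MvPolynomial.C c := MvPolynomial.aeval_C _ _
    rw [this, intCoeff_C]
    simp
  | add p q hp hq => rw [map_add, map_add, map_add, hp, hq]
  | mul_X p i hp =>
    rw [mul_comm p, hallForm_X_mul, Derivation.leibniz_finsetProd, map_sum, LinearMap.sum_apply]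
    have h1 : ∀ k : Fin N, (∏ l ∈ Finset.univ.erase k, completeHInt (a l)) *
        MvPolynomial.pderiv i (completeHInt (a k)) =
        ∏ l, completeHInt (a l - (Finsupp.single k (i : ℕ) l : ℕ)) := by
      intro k
      rw [← Finset.mul_prod_erase Finset.univ _ (Finset.mem_univ k), mul_comm,
        pderiv_completeHInt]
      congr 1
      · simp
      · refine Finset.prod_congr rfl fun l hl => ?_
        rw [Finsupp.single_eq_of_ne (Finset.ne_of_mem_erase hl)]
        simp
    have h2 : toPowerSums N (MvPolynomial.X i * p) = (1 / (i : ℂ)) •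
        ∑ k, MvPolynomial.monomial (Finsupp.single k (i : ℕ)) 1 * toPowerSums N p := by
      rw [map_mul, toPowerSums, MvPolynomial.aeval_X, powerSumVal, mul_assoc,
        ← MvPolynomial.smul_eq_C_mul, Finset.sum_mul]
      simp_rw [MvPolynomial.X_pow_eq_monomial]
    rw [h2, map_smul, map_sum, smul_eq_mul]
    congr 1
    refine Finset.sum_congr rfl fun k _ => ?_
    rw [h1, hp, intCoeff_monomial_mul]

/-- The alternant `det (x_k^{μ_j + N - 1 - j})`. -/
def alternant (N : ℕ) (μ : YoungDiagram) : MvPolynomial (Fin N) ℂ :=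
  (Matrix.of fun k j : Fin N => MvPolynomial.X k ^ (μ.rowLen j + (N - 1 - j))).det

theorem rowLen_bot (i : ℕ) : (⊥ : YoungDiagram).rowLen i = 0 := by
  by_contra h
  exact YoungDiagram.notMem_bot (i, 0) (YoungDiagram.mem_iff_lt_rowLen.2 (Nat.pos_of_ne_zero h))

theorem prod_X_pow_eq_monomial (b : Fin N → ℕ) :
    ∏ k, (MvPolynomial.X k : MvPolynomial (Fin N) ℂ) ^ b k =
      MvPolynomial.monomial (Finsupp.equivFunOnFinite.symm b) 1 := by
  rw [MvPolynomial.monomial_eq, Finsupp.prod_fintype _ _ (by simp)]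
  simp

theorem alternant_eq_sum (μ : YoungDiagram) :
    alternant N μ = ∑ σ : Equiv.Perm (Fin N), ((Equiv.Perm.sign σ : ℤ) : ℂ) •
      MvPolynomial.monomial (Finsupp.equivFunOnFinite.symm
        fun k => μ.rowLen (σ k) + (N - 1 - σ k)) 1 := by
  rw [alternant, ← Matrix.det_transpose, Matrix.det_apply']
  refine Finset.sum_congr rfl fun σ _ => ?_
  rw [← prod_X_pow_eq_monomial, MvPolynomial.smul_eq_C_mul]
  simp

/-- Pairing with `s_μ` extracts the coefficient of `x^{μ+δ}`, `δ = (N - 1, …, 1, 0)`, of the product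
with the Vandermonde determinant `a_δ`: expand the Jacobi–Trudi determinant into products of
complete symmetric functions. -/
theorem hallForm_schur {μ : YoungDiagram} (hN : μ.colLen 0 ≤ N) (Q : MvPolynomial ℕ+ ℂ) :
    hallForm (schur μ) Q = intCoeff (fun k : Fin N => ((μ.rowLen k + (N - 1 - k) : ℕ) : ℤ))
      (alternant N ⊥ * toPowerSums N Q) := by
  rw [schur_eq_det hN, ← Matrix.det_transpose, Matrix.det_apply', alternant_eq_sum,
    Finset.sum_mul, map_sum, map_sum, LinearMap.sum_apply]
  refine Finset.sum_congr rfl fun σ _ => ?_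
  have h1 : ((Equiv.Perm.sign σ : ℤ) : MvPolynomial ℕ+ ℂ) =
      MvPolynomial.C ((Equiv.Perm.sign σ : ℤ) : ℂ) := by simp
  rw [h1, ← MvPolynomial.smul_eq_C_mul, map_smul, LinearMap.smul_apply, smul_mul_assoc, map_smul,
    intCoeff_monomial_mul]
  congr 1
  simp only [Matrix.transpose_apply, Matrix.of_apply]
  rw [hallForm_prod_completeHInt]
  congr 2
  ext k
  have h2 := k.2
  have h3 := (σ k).2
  simp only [Finsupp.equivFunOnFinite_symm_apply_apply, rowLen_bot]
  lia

/-- The power series `1 / (1 - x_k z)`. -/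
def geomSeries (k : Fin N) : PowerSeries (MvPolynomial (Fin N) ℂ) :=
  PowerSeries.mk fun n => MvPolynomial.X k ^ n

/-- The polynomial `1 - x_k z`. -/
def linFactor (k : Fin N) : Polynomial (MvPolynomial (Fin N) ℂ) :=
  1 - Polynomial.C (MvPolynomial.X k) * Polynomial.X

theorem coe_linFactor (k : Fin N) : (linFactor k : PowerSeries (MvPolynomial (Fin N) ℂ)) =
    1 - PowerSeries.C (MvPolynomial.X k) * PowerSeries.X := by
  simp [linFactor]

theorem geomSeries_mul_linFactor (k : Fin N) :
    geomSeries k * (linFactor k : PowerSeries (MvPolynomial (Fin N) ℂ)) = 1 := by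
  rw [coe_linFactor]
  ext n
  cases n with
  | zero => simp [geomSeries, mul_sub]
  | succ n =>
    rw [mul_sub, mul_one, mul_comm (PowerSeries.C _), ← mul_assoc, map_sub,
      PowerSeries.coeff_mul_C, PowerSeries.coeff_succ_mul_X, geomSeries, PowerSeries.coeff_mk,
      PowerSeries.coeff_mk, PowerSeries.coeff_one, if_neg (Nat.succ_ne_zero n), pow_succ, sub_self]

theorem derivative_linFactor (k : Fin N) :
    PowerSeries.derivative (MvPolynomial (Fin N) ℂ)
        (linFactor k : PowerSeries (MvPolynomial (Fin N) ℂ)) =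
      -PowerSeries.C (MvPolynomial.X k) := by
  rw [coe_linFactor, map_sub, PowerSeries.derivative_one, Derivation.leibniz,
    PowerSeries.derivative_C, PowerSeries.derivative_X]
  simp

/-- The generating function `∑ h_n zⁿ = ∏_k 1 / (1 - x_k z)`, from the logarithmic derivatives. -/
theorem hSeries_mul_prod_linFactor :
    hSeries (powerSumVal N) *
      ∏ k : Fin N, (linFactor k : PowerSeries (MvPolynomial (Fin N) ℂ)) = 1 := by
  classical
  apply PowerSeries.derivative.ext
  · have h1 : PowerSeries.derivative _ (flowSeries (powerSumVal N)) =
        ∑ k, PowerSeries.C (MvPolynomial.X k) * geomSeries k := by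
      ext1 n
      rw [PowerSeries.coeff_derivative, coeff_flowSeries_succ, map_sum, powerSumVal]
      simp only [PowerSeries.coeff_C_mul, geomSeries, PowerSeries.coeff_mk, Nat.succPNat_coe]
      have h2 : (MvPolynomial.C (1 / ((n.succ : ℕ) : ℂ)) : MvPolynomial (Fin N) ℂ) *
          ((n : MvPolynomial (Fin N) ℂ) + 1) = 1 := by
        have h3 : ((n : MvPolynomial (Fin N) ℂ) + 1) = MvPolynomial.C ((n.succ : ℕ) : ℂ) := by
          simp
        have h4 : ((n.succ : ℕ) : ℂ) ≠ 0 := Nat.cast_ne_zero.2 (Nat.succ_ne_zero n)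
        rw [h3, ← MvPolynomial.C_mul, one_div_mul_cancel h4, MvPolynomial.C_1]
      rw [mul_right_comm, h2, one_mul]
      exact Finset.sum_congr rfl fun k _ => by rw [Nat.succ_eq_add_one, pow_succ, mul_comm]
    rw [Derivation.leibniz, Derivation.leibniz_finsetProd, derivative_hSeries, h1,
      PowerSeries.derivative_one]
    simp only [smul_eq_mul, derivative_linFactor]
    rw [mul_left_comm, ← mul_add]
    convert mul_zero _
    rw [Finset.mul_sum, ← Finset.sum_add_distrib]
    refine Finset.sum_eq_zero fun k _ => ?_
    rw [← Finset.mul_prod_erase Finset.univ _ (Finset.mem_univ k)]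
    linear_combination (∏ l ∈ Finset.univ.erase k,
      (linFactor l : PowerSeries (MvPolynomial (Fin N) ℂ))) *
      PowerSeries.C (MvPolynomial.X k) * geomSeries_mul_linFactor k
  · rw [map_mul, map_prod, ← PowerSeries.coeff_zero_eq_constantCoeff_apply, coeff_zero_hSeries]
    simp [coe_linFactor]

/-- The coefficients of `∏_{l ≠ k} (1 - x_l z)`. -/
def omitCoeff (k : Fin N) (j : ℕ) : MvPolynomial (Fin N) ℂ :=
  (∏ l ∈ Finset.univ.erase k, linFactor l).coeff j

theorem omitCoeff_eq_zero (k : Fin N) {j : ℕ} (hj : N ≤ j) : omitCoeff k j = 0 := by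
  refine Polynomial.coeff_eq_zero_of_natDegree_lt ?_
  have h1 : (∏ l ∈ Finset.univ.erase k, linFactor l).natDegree ≤
      ∑ l ∈ Finset.univ.erase k, 1 := by
    refine (Polynomial.natDegree_prod_le _ _).trans (Finset.sum_le_sum fun l _ => ?_)
    refine (Polynomial.natDegree_sub_le _ _).trans ?_
    rw [Polynomial.natDegree_one]
    exact max_le (Nat.zero_le _)
      ((Polynomial.natDegree_C_mul_le _ _).trans Polynomial.natDegree_X_le)
  have := k.2
  simp at h1
  lia

/-- `x_k^n = ∑_j h_{n-j} e_j`, where `∑_j e_j z^j = ∏_{l ≠ k} (1 - x_l z)`. -/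
theorem X_pow_eq_sum (k : Fin N) (n : ℕ) :
    MvPolynomial.X k ^ n =
      ∑ j ∈ Finset.range N, toPowerSums N (completeHInt ((n : ℤ) - j)) * omitCoeff k j := by
  classical
  have h1 : hSeries (powerSumVal N) * ((∏ l ∈ Finset.univ.erase k, linFactor l :
      Polynomial (MvPolynomial (Fin N) ℂ)) : PowerSeries (MvPolynomial (Fin N) ℂ)) =
      geomSeries k := by
    have h2 := hSeries_mul_prod_linFactor (N := N)
    rw [← Finset.mul_prod_erase Finset.univ _ (Finset.mem_univ k)] at h2
    have h3 : ((∏ l ∈ Finset.univ.erase k, linFactor l :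
        Polynomial (MvPolynomial (Fin N) ℂ)) : PowerSeries (MvPolynomial (Fin N) ℂ)) =
        ∏ l ∈ Finset.univ.erase k, (linFactor l : PowerSeries (MvPolynomial (Fin N) ℂ)) := by
      simp only [← Polynomial.coeToPowerSeries.ringHom_apply, map_prod]
    rw [h3]
    linear_combination geomSeries k * h2 - hSeries (powerSumVal N) *
      (∏ l ∈ Finset.univ.erase k, (linFactor l : PowerSeries (MvPolynomial (Fin N) ℂ))) *
      geomSeries_mul_linFactor k
  have h2 := congrArg (PowerSeries.coeff n) h1
  rw [PowerSeries.coeff_mul, geomSeries, PowerSeries.coeff_mk,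
    ← Finset.Nat.sum_antidiagonal_swap] at h2
  simp only [Prod.fst_swap, Prod.snd_swap, Polynomial.coeff_coe, hSeries,
    PowerSeries.coeff_mk] at h2
  rw [Finset.Nat.sum_antidiagonal_eq_sum_range_succ (fun i j =>
    MvPolynomial.aeval (powerSumVal N) (completeH j) *
      (∏ l ∈ Finset.univ.erase k, linFactor l).coeff i)] at h2
  rw [← h2]
  have h4 : ∀ j ∈ Finset.range n.succ, MvPolynomial.aeval (powerSumVal N) (completeH (n - j)) *
      (∏ l ∈ Finset.univ.erase k, linFactor l).coeff j =
      toPowerSums N (completeHInt ((n : ℤ) - j)) * omitCoeff k j := by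
    intro j hj
    have hj' : j ≤ n := by simpa [Nat.lt_succ_iff] using hj
    rw [← Nat.cast_sub hj', completeHInt_natCast]
    rfl
  rw [Finset.sum_congr rfl h4]
  have h5 : ∀ j, n < j → toPowerSums N (completeHInt ((n : ℤ) - j)) * omitCoeff k j = 0 := by
    intro j hj
    rw [completeHInt_of_neg (by lia), map_zero, zero_mul]
  have h6 : ∀ j, N ≤ j → toPowerSums N (completeHInt ((n : ℤ) - j)) * omitCoeff k j = 0 := by
    intro j hj
    rw [omitCoeff_eq_zero k hj, mul_zero]
  rw [Finset.sum_subset (Finset.range_subset_range.2 (le_max_left n.succ N)),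
    Finset.sum_subset (Finset.range_subset_range.2 (le_max_right n.succ N))]
  · intro j _ hj
    exact h6 j (by simpa using hj)
  · intro j _ hj
    exact h5 j (by simpa using hj)

/-- The bialternant formula: `a_{μ+δ} = s_μ a_δ`. -/
theorem alternant_eq_mul {μ : YoungDiagram} (hN : μ.colLen 0 ≤ N) :
    alternant N μ = toPowerSums N (schur μ) * alternant N ⊥ := by
  -- `a_{ν+δ}` factors through a matrix `M` independent of `ν`, whose determinant is then `a_δ`
  set M : Matrix (Fin N) (Fin N) (MvPolynomial (Fin N) ℂ) :=
    Matrix.of fun j k => omitCoeff k (N - 1 - j) with hM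
  have key : ∀ ν : YoungDiagram, ν.colLen 0 ≤ N →
      alternant N ν = toPowerSums N (schur ν) * M.det := by
    intro ν hν
    rw [schur_eq_det hν, AlgHom.map_det, ← Matrix.det_mul, alternant, ← Matrix.det_transpose]
    congr 1
    ext1 i k
    have hi := i.2
    rw [Matrix.transpose_apply, Matrix.of_apply, X_pow_eq_sum, Matrix.mul_apply,
      ← Fin.sum_univ_eq_sum_range (fun j => toPowerSums N
        (completeHInt (((ν.rowLen i + (N - 1 - i) : ℕ) : ℤ) - j)) * omitCoeff k j),
      ← Equiv.sum_comp (Fin.revPerm (n := N))]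
    refine Finset.sum_congr rfl fun j _ => ?_
    have hj := j.2
    simp only [hM, AlgHom.mapMatrix_apply, Matrix.map_apply, Matrix.of_apply, Fin.revPerm_apply,
      Fin.val_rev]
    have e1 : N - (j + 1 : ℕ) = N - 1 - j := by lia
    rw [e1]
    congr 3
    lia
  have hbot : (⊥ : YoungDiagram).colLen 0 = 0 :=
    Nat.le_zero.1 (rowLen_eq_zero_iff.1 (rowLen_bot 0))
  have h0 : schur ⊥ = 1 := by
    rw [schur_eq_det (N := 0) hbot.le, Matrix.det_fin_zero]
  rw [key μ hN, key ⊥ (by lia), h0, map_one, one_mul]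

open Classical in
/-- The exponents of `a_{ν+δ}` are the permutations of the strictly decreasing sequence `ν + δ`, and
only the identity permutation gives a decreasing exponent. -/
theorem intCoeff_alternant {μ ν : YoungDiagram} (hμ : μ.colLen 0 ≤ N) (hν : ν.colLen 0 ≤ N) :
    intCoeff (fun k : Fin N => ((μ.rowLen k + (N - 1 - k) : ℕ) : ℤ)) (alternant N ν) =
      if ν = μ then 1 else 0 := by
  classical
  have hanti : ∀ ρ : YoungDiagram, StrictAnti fun k : Fin N => ρ.rowLen k + (N - 1 - k) := by
    intro ρ a b hab
    rw [Fin.lt_def] at hab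
    have := ρ.rowLen_anti a b hab.le
    have := b.2
    simp only
    lia
  have hc : ∀ b : Fin N → ℕ,
      intCoeff (fun k : Fin N => ((μ.rowLen k + (N - 1 - k) : ℕ) : ℤ))
        (MvPolynomial.monomial (Finsupp.equivFunOnFinite.symm b) 1) =
      if b = fun k : Fin N => μ.rowLen k + (N - 1 - k) then 1 else 0 := by
    intro b
    rw [intCoeff, if_pos fun k => by positivity, MvPolynomial.lcoeff_apply,
      MvPolynomial.coeff_monomial]
    simp only [Int.toNat_natCast, EmbeddingLike.apply_eq_iff_eq]
  rw [alternant_eq_sum, map_sum]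
  simp_rw [map_smul, hc]
  have hσ : ∀ σ : Equiv.Perm (Fin N),
      ((fun k => ν.rowLen (σ k) + (N - 1 - σ k)) =
        fun k : Fin N => μ.rowLen k + (N - 1 - k)) ↔ σ = 1 ∧ ν = μ := by
    intro σ
    constructor
    · intro h
      have hmono : StrictMono σ := by
        intro a b hab
        have h1 := hanti μ hab
        simp only [← congrFun h] at h1
        exact (hanti ν).lt_iff_gt.1 h1
      have h1 : σ = 1 := by
        ext i
        have := Subsingleton.elim (hmono.orderIsoOfSurjective σ σ.surjective) (OrderIso.refl _)
        exact congrArg Fin.val (DFunLike.congr_fun this i)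
      subst h1
      refine ⟨rfl, youngDiagram_ext fun i => ?_⟩
      by_cases hi : i < N
      · have := congrFun h ⟨i, hi⟩
        simp only [Equiv.Perm.one_apply] at this
        lia
      · rw [rowLen_eq_zero_iff.2 (by lia), rowLen_eq_zero_iff.2 (by lia)]
    · rintro ⟨rfl, rfl⟩
      rfl
  simp_rw [hσ]
  rw [Finset.sum_eq_single 1]
  · simp
  · intro σ _ hσ1
    simp [hσ1]
  · simp

end Alternants

open Classical in
/-- Schur functions are orthonormal: `s_λ(∂_t) s_μ |_{t = 0} = δ_{λμ}`. -/
theorem hallForm_schur_schur (μ ν : YoungDiagram) :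
    hallForm (schur μ) (schur ν) = if ν = μ then 1 else 0 := by
  rw [hallForm_schur (N := max (μ.colLen 0) (ν.colLen 0)) (le_max_left _ _), mul_comm,
    ← alternant_eq_mul (le_max_right _ _),
    intCoeff_alternant (le_max_left _ _) (le_max_right _ _)]

/-! ### The tau function -/

theorem isFlowParam_extendZero (s : Finset ℕ+) (u : s → ℂ) : IsFlowParam (extendZero s u) := by
  have h : ∀ i ∉ s, extendZero s u i = 0 := fun i hi => dif_neg hi
  exact ⟨summable_of_ne_finset_zero (s := s) fun i hi => by rw [h i hi, norm_zero],
    summable_of_ne_finset_zero (s := s) fun i hi => by simp [h i hi]⟩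

/-- On bounded sets of finitely many flow variables the bound on `∑ |s_λ(t)|²` is uniform. -/
theorem schurBound_extendZero_le {s : Finset ℕ+} {R : ℝ} {u : s → ℂ} (hu : ‖u‖ ≤ R) :
    schurBound (extendZero s u) ≤ Real.exp (Real.exp (∑ _i ∈ s, R) ^ 2 *
      (Real.exp (∑ _i ∈ s, R) ^ 2 * ∑ i ∈ s, ((i : ℕ) : ℝ) * R ^ 2)) := by
  have h0 : ∀ i ∉ s, extendZero s u i = 0 := fun i hi => dif_neg hi
  have h1 : ∀ i ∈ s, ‖extendZero s u i‖ ≤ R := fun i hi => by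
    rw [extendZero, dif_pos hi]
    exact (norm_le_pi_norm u _).trans hu
  have h2 : ∑' i, ‖extendZero s u i‖ ≤ ∑ _i ∈ s, R := by
    rw [tsum_eq_sum (s := s) fun i hi => by rw [h0 i hi, norm_zero]]
    exact Finset.sum_le_sum h1
  have h3 : ∑' i : ℕ+, ((i : ℕ) : ℝ) * ‖extendZero s u i‖ ^ 2 ≤
      ∑ i ∈ s, ((i : ℕ) : ℝ) * R ^ 2 := by
    rw [tsum_eq_sum (s := s) fun i hi => by simp [h0 i hi]]
    refine Finset.sum_le_sum fun i hi => ?_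
    gcongr
    exact h1 i hi
  have h4 : 0 ≤ ∑' i : ℕ+, ((i : ℕ) : ℝ) * ‖extendZero s u i‖ ^ 2 :=
    tsum_nonneg fun i => by positivity
  rw [schurBound]
  gcongr

/-- The row `λ_k - k` along `e_i = z^{-i-1}` is, with `k` counted from `0`, the row of the exponent
`k - λ_{k+1}` of `z`. -/
theorem rowsOf_frameMatrix (f : ℕ → H) (μ : YoungDiagram) :
    rowsOf μ (frameMatrix f) =
      Matrix.of fun k j : ℕ => fourierCoeff (f j) ((k : ℤ) - μ.rowLen k) := by
  ext k j
  simp only [rowsOf, frameMatrix, coordMatrix, Matrix.of_apply]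
  congr 1
  ring

theorem rowsOf_bot_flowMatrix (f : ℕ → H) (t : ℕ+ → ℂ) :
    rowsOf ⊥ (flowMatrix f t) =
      Matrix.of fun n j : ℕ => fourierCoeff (fun x => gamma t x * f j x) (n : ℤ) := by
  ext k j
  simp only [rowsOf, flowMatrix, coordMatrix, Matrix.of_apply, rowLen_bot]
  congr 1
  push_cast
  ring

variable {w : Submodule ℂ H} {f : ℕ → H}

theorem IsAdmissibleFrame.hasInfDet_plucker (hw : w ∈ Gr) (hf : IsAdmissibleFrame w f)
    (μ : YoungDiagram) : HasInfDet (rowsOf μ (frameMatrix f)) (plucker f μ) := by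
  obtain ⟨d, hd⟩ := (hf.isNearStandard hw).exists_hasInfDet μ
  rw [← rowsOf_frameMatrix] at hd
  exact hd.infDet

/-- The square summability of the Plücker coordinates and the Schur expansion of the tau function
at `t`. -/
theorem IsAdmissibleFrame.hasInfDet_flowMatrix (hw : w ∈ Gr) (hf : IsAdmissibleFrame w f)
    {t : ℕ+ → ℂ} (ht : IsFlowParam t) :
    (Summable fun μ => ‖plucker f μ‖ ^ 2) ∧ HasInfDet (rowsOf ⊥ (flowMatrix f t))
      (∑' μ, plucker f μ * MvPolynomial.eval t (schur μ)) := by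
  rw [rowsOf_bot_flowMatrix]
  refine (hf.isNearStandard hw).schur_expansion (fun μ => ?_) ht
    fun n j => hasSum_fourierCoeff_gamma_mul ht.1 (f j) n
  have h := hf.hasInfDet_plucker hw μ
  rw [rowsOf_frameMatrix] at h
  exact h

theorem IsAdmissibleFrame.tau_eq (hw : w ∈ Gr) (hf : IsAdmissibleFrame w f) {t : ℕ+ → ℂ}
    (ht : IsFlowParam t) : tau f t = ∑' μ, plucker f μ * MvPolynomial.eval t (schur μ) :=
  (hf.hasInfDet_flowMatrix hw ht).2.limUnder_eq

theorem IsAdmissibleFrame.summable_norm_plucker_sq (hw : w ∈ Gr) (hf : IsAdmissibleFrame w f) :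
    Summable fun μ => ‖plucker f μ‖ ^ 2 :=
  (hf.hasInfDet_flowMatrix hw (isFlowParam_extendZero ∅ 0)).1

/-- The partial sum over the finite set `S` of the Schur expansion of the tau function. -/
def schurPartialSum (f : ℕ → H) (S : Finset YoungDiagram) : MvPolynomial ℕ+ ℂ :=
  ∑ μ ∈ S, plucker f μ • schur μ

/-- The tail of the expansion is bounded by Cauchy–Schwarz, uniformly on balls. -/
theorem IsAdmissibleFrame.tendstoUniformlyOn_tau (hw : w ∈ Gr) (hf : IsAdmissibleFrame w f)
    (s : Finset ℕ+) (R : ℝ) :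
    TendstoUniformlyOn
      (fun S (u : s → ℂ) => MvPolynomial.eval (extendZero s u) (schurPartialSum f S))
      (fun u => tau f (extendZero s u)) atTop (Metric.closedBall 0 R) := by
  set B : ℝ := Real.exp (Real.exp (∑ _i ∈ s, R) ^ 2 *
      (Real.exp (∑ _i ∈ s, R) ^ 2 * ∑ i ∈ s, ((i : ℕ) : ℝ) * R ^ 2))
  have hp := hf.summable_norm_plucker_sq hw
  have hlim : Tendsto (fun S : Finset YoungDiagram =>
      √(∑' μ, ‖plucker f μ‖ ^ 2 - ∑ μ ∈ S, ‖plucker f μ‖ ^ 2) * √B) atTop (𝓝 0) := by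
    have h1 : Tendsto (fun S : Finset YoungDiagram => ∑ μ ∈ S, ‖plucker f μ‖ ^ 2) atTop
        (𝓝 (∑' μ, ‖plucker f μ‖ ^ 2)) := hp.hasSum
    have h2 := (h1.const_sub (∑' μ, ‖plucker f μ‖ ^ 2)).sqrt.mul_const (√B)
    rwa [sub_self, Real.sqrt_zero, zero_mul] at h2
  rw [Metric.tendstoUniformlyOn_iff]
  intro ε hε
  filter_upwards [hlim.eventually_lt_const hε] with S hS u hu
  have ht := isFlowParam_extendZero s u
  have hs := summable_norm_schur_sq ht
  rw [mem_closedBall_zero_iff] at hu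
  refine lt_of_le_of_lt ?_ hS
  rw [dist_eq_norm, hf.tau_eq hw ht, schurPartialSum, map_sum]
  simp only [MvPolynomial.smul_eval]
  refine (norm_tsum_mul_sub_sum_le hp hs.1 S).trans ?_
  gcongr
  exact hs.2.trans (schurBound_extendZero_le hu)

theorem polyDt_schur_schurPartialSum {μ : YoungDiagram} {S : Finset YoungDiagram} (hμ : μ ∈ S) :
    polyDt (schur μ) (fun t => MvPolynomial.eval t (schurPartialSum f S)) 0 = plucker f μ := by
  classical
  rw [polyDt_eval, schurPartialSum, map_sum]
  simp [hallForm_schur_schur, hμ]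

/-- Constant coefficient differential operators may be applied termwise to the expansion. -/
theorem IsAdmissibleFrame.tendsto_polyDt (hw : w ∈ Gr) (hf : IsAdmissibleFrame w f)
    (P : MvPolynomial ℕ+ ℂ) :
    Tendsto (fun S => polyDt P (fun t => MvPolynomial.eval t (schurPartialSum f S)) 0) atTop
      (𝓝 (polyDt P (tau f) 0)) := by
  classical
  refine tendsto_finsetSum _ fun α _ => Tendsto.const_mul _ ?_
  have h := (tendsto_foldr_dt (s := α.support)
    (F := fun S t => MvPolynomial.eval t (schurPartialSum f S)) (f := tau f)
    (fun S => contDiff_eval_extendZero α.support (schurPartialSum f S))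
    (hf.tendstoUniformlyOn_tau hw α.support) ((Finsupp.toMultiset α).sort (· ≤ ·))
    fun i hi => by simpa using hi).2 0
  have h0 := h.tendsto_at (Metric.mem_closedBall_self le_rfl)
  simp only [extendZero_zero] at h0
  exact h0

end KP

end

theorem mainTheorem6 (w : Submodule ℂ KP.H) (hw : w ∈ KP.Gr)
    (f : ℕ → KP.H) (hf : KP.IsAdmissibleFrame w f) :
    -- the determinants defining the Plücker coordinates and the tau function exist
    (∀ μ : YoungDiagram,
      KP.HasInfDet (KP.rowsOf μ (KP.frameMatrix f)) (KP.plucker f μ)) ∧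
    (∀ t : ℕ+ → ℂ, KP.IsFlowParam t →
      KP.HasInfDet (KP.rowsOf ⊥ (KP.flowMatrix f t)) (KP.tau f t)) ∧
    -- the Schur function expansion, absolutely convergent
    (∀ t : ℕ+ → ℂ, KP.IsFlowParam t →
      HasSum (fun μ : YoungDiagram => KP.plucker f μ * MvPolynomial.eval t (KP.schur μ))
        (KP.tau f t)) ∧
    -- the tau function is holomorphic in any finite number of flow variables, and the Plücker
    -- coordinates are the values at the origin of its derivatives along the Schur operators
    (∀ s : Finset ℕ+, ContDiff ℂ (⊤ : ℕ∞) fun u : s → ℂ => KP.tau f (KP.extendZero s u)) ∧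
    (∀ μ : YoungDiagram, KP.plucker f μ = KP.polyDt (KP.schur μ) (KP.tau f) 0) := by
  refine ⟨hf.hasInfDet_plucker hw, fun t ht => ?_, fun t ht => ?_, fun s => ?_, fun μ => ?_⟩
  · rw [hf.tau_eq hw ht]
    exact (hf.hasInfDet_flowMatrix hw ht).2
  · rw [hf.tau_eq hw ht]
    exact (KP.summable_mul_of_sq (hf.summable_norm_plucker_sq hw)
      (KP.summable_norm_schur_sq ht).1).hasSum
  · exact KP.contDiff_of_tendstoUniformlyOn
      (fun S => KP.contDiff_eval_extendZero s (KP.schurPartialSum f S))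
      (hf.tendstoUniformlyOn_tau hw s)
  · refine tendsto_nhds_unique ?_ (hf.tendsto_polyDt hw (KP.schur μ))
    refine tendsto_const_nhds.congr' ?_
    filter_upwards [eventually_ge_atTop {μ}] with S hS
    exact (KP.polyDt_schur_schurPartialSum (hS (Finset.mem_singleton_self μ))).symm
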